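/- **Setting.** Let $d\ge 1$ and let $K\subseteq\mathbb R^d$ be a convex body (compact, convex, with non-empty interior) of diameter $\delta_K$. Let $\mu=(\mu_j)_{j\ge1}$ be a sequence with $0<\mu_1\le\mu_2\le\cdots<\infty$ and $$\sum_{j=1}^\infty \frac1{\mu_j} > e\,\delta_K .$$ Put $$N-1 := \sup\Big\{n\in\mathbb N:\ \sum_{j=1}^n \frac{1}{\delta_K\mu_j}<e\Big\},$$ which is a finite number. Let $\tilde\mu:[1,\infty)\to(0,\infty)$ be any increasing, continuous, piecewise $\mathcal C^1$ function with $\tilde\mu(k)=\mu_k$ for all integers $k\ge1$, where $\tilde\mu'$ denotes the left derivative at points where $\tilde\mu$ is not differentiable (and the right derivative at $1$). For $N\ge 2$ set $$C_N := 4\exp\Big(4+\sup_{1\le s\le 2(N-1)}\frac{s\,\tilde\mu'(s)}{\tilde\mu(s)}\Big).$$ For a function $g$ on $K$ let $\|g\|_K=\sup_{x\in K}|g(x)|$. Let $f:K\to\mathbb R$ be of class $\mathcal C^{2(N-1)}$ in an open neighbourhood of $K$, with $\|f\|_K>0$ and $$\sum_{|\alpha|=j}\frac{j!}{\alpha!}\,\|f^{(\alpha)}\|_K\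 \le\ \|f\|_K\,\mu_1\mu_2\cdots\mu_j ,\qquad 0\le j\le 2(N-1).$$ **Statement.** For each Euclidean ball $B\subseteq K$ (of positive radius, open or closed), $$\frac1{|B|}\int_B\Big|\log|f(x)|-\frac1{|B|}\int_B\log|f(y)|\,dy\Big|\,dx\ \le\ 4(N-1)\Big(\log\Big(\frac{C_N\,d\,|K|}{|B|}\Big)+1\Big),$$ where $|\cdot|$ applied to sets is Lebesgue measure. If $N\ge2$, this includes the assertion that $f\neq0$ almost everywhere on $B$ and that $\log|f|$ is integrable on $B$. If $N=1$, the right-hand side is interpreted as $\infty$ and nothing is asserted. -/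

import Mathlib

open MeasureTheory Set Filter Topology

noncomputable section

/-- A convex body in `ℝ^d`: a compact convex set with non-empty interior. -/
structure IsFullConvexBody {d : ℕ} (K : Set (EuclideanSpace ℝ (Fin d))) : Prop where
  compact : IsCompact K
  convex : Convex ℝ K
  nonempty_interior : (interior K).Nonempty

/-- `B` is a Euclidean ball (open or closed) of positive radius. -/
def IsEuclideanBall {d : ℕ} (B : Set (EuclideanSpace ℝ (Fin d))) : Prop :=
  ∃ (c : EuclideanSpace ℝ (Fin d)) (r : ℝ), 0 < r ∧
    (B = Metric.ball c r ∨ B = Metric.closedBall c r)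

/-! ### Weights and their degree -/

/-- An admissible weight `(μ_j)_{j ≥ 1}` with all entries finite: positive and increasing
(not necessarily strictly). The entry `μ 0` plays no role. -/
structure IsAdmissibleWeight (μ : ℕ → ℝ) : Prop where
  pos : ∀ j, 1 ≤ j → 0 < μ j
  mono : ∀ j, 1 ≤ j → μ j ≤ μ (j + 1)

/-- The partial sum `Σ_μ(m, n) = ∑_{j=m}^n 1 / μ_j`, for finite `n`. -/
def weightSum (μ : ℕ → ℝ) (m n : ℕ) : ℝ := ∑ j ∈ Finset.Icc m n, 1 / μ j

/-- The tail `Σ_μ(m, ∞) = ∑_{j=m}^∞ 1 / μ_j`, with values in `[0, ∞]`. -/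
def weightTail (μ : ℕ → ℝ) (m : ℕ) : ENNReal := ∑' i : ℕ, ENNReal.ofReal (1 / μ (m + i))

/-- `j_0(b)`: the smallest natural number `j` with `j ≥ log (1 / b)`. -/
def startIndex (b : ℝ) : ℕ := ⌈Real.log b⁻¹⌉₊

/-- The `μ`-degree `𝔡_μ(b) = sup {n ∈ ℕ : Σ_μ(j_0(b) + 1, n) < e} ∈ ℕ ∪ {∞}`. -/
def weightDegree (μ : ℕ → ℝ) (b : ℝ) : ℕ∞ :=
  ⨆ n ∈ {n : ℕ | weightSum μ (startIndex b + 1) n < Real.exp 1}, (n : ℕ∞)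

/-- `(μ, K)` is admissible data with associated integer `N`: `μ` is an admissible weight, `K` is a
convex body, `Σ_μ(1, ∞) > e · diam K`, and `N = 𝔡_{(diam K) μ}(1) + 1`. -/
structure IsAdmissibleData {d : ℕ} (μ : ℕ → ℝ) (K : Set (EuclideanSpace ℝ (Fin d)))
    (N : ℕ) : Prop where
  weight : IsAdmissibleWeight μ
  body : IsFullConvexBody K
  sum_gt : ENNReal.ofReal (Metric.diam K * Real.exp 1) < weightTail μ 1
  eq_degree : (N : ℕ∞) = weightDegree (fun j => Metric.diam K * μ j) 1 + 1

/-! ### Functions with controlled derivatives -/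

/-- The first order partial derivative `∂_i f`. -/
def partialD {d : ℕ} (i : Fin d) (f : EuclideanSpace ℝ (Fin d) → ℝ) :
    EuclideanSpace ℝ (Fin d) → ℝ :=
  fun x => lineDeriv ℝ f x (EuclideanSpace.single i 1)

/-- The partial derivative `f^(α) = ∂_0^{α_0} ⋯ ∂_{d-1}^{α_{d-1}} f` for a multi-index `α`. -/
def multiPartialD {d : ℕ} (α : Fin d → ℕ) (f : EuclideanSpace ℝ (Fin d) → ℝ) :
    EuclideanSpace ℝ (Fin d) → ℝ :=
  (List.finRange d).foldr (fun i g => (partialD i)^[α i] g) f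

/-- The sup-norm `‖g‖_K = sup_{x ∈ K} |g x|`. -/
def supNormOn {d : ℕ} (K : Set (EuclideanSpace ℝ (Fin d)))
    (g : EuclideanSpace ℝ (Fin d) → ℝ) : ℝ :=
  ⨆ x : K, |g x|

/-- `‖f‖_{j,K} = ∑_{|α| = j} (j! / α!) ‖f^(α)‖_K`. -/
def derivNormOn {d : ℕ} (j : ℕ) (K : Set (EuclideanSpace ℝ (Fin d)))
    (f : EuclideanSpace ℝ (Fin d) → ℝ) : ℝ :=
  ∑ α ∈ Finset.piAntidiag (Finset.univ : Finset (Fin d)) j,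
    (Nat.multinomial Finset.univ α : ℝ) * supNormOn K (multiPartialD α f)

/-- `f` is `(μ^{|n}, M₀)`-smooth on `K`, for finite `n`, where `μ^{|n}` is the weight that agrees
with `μ` up to the index `n` and is `∞` afterwards: `M₀ > 0`, `f` is of class `C^n` in an open
neighbourhood of `K`, and `‖f‖_{j,K} ≤ M₀ μ_1 ⋯ μ_j` for `0 ≤ j ≤ n`. -/
def IsWeightSmooth {d : ℕ} (μ : ℕ → ℝ) (n : ℕ) (M₀ : ℝ)
    (K : Set (EuclideanSpace ℝ (Fin d))) (f : EuclideanSpace ℝ (Fin d) → ℝ) : Prop :=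
  0 < M₀ ∧
  (∃ U : Set (EuclideanSpace ℝ (Fin d)), IsOpen U ∧ K ⊆ U ∧ ContDiffOn ℝ (n : ℕ∞) f U) ∧
  ∀ j ≤ n, derivNormOn j K f ≤ M₀ * ∏ i ∈ Finset.Icc 1 j, μ i

/-! ### The constant `C_N` -/

/-- `m : [1, ∞) → (0, ∞)` is an increasing continuous piecewise `C^1` function that interpolates
the weight `μ` (values of `m` outside `[1, ∞)` play no role). -/
structure IsWeightInterpolant (m : ℝ → ℝ) (μ : ℕ → ℝ) : Prop where
  pos : ∀ s, 1 ≤ s → 0 < m s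
  mono : MonotoneOn m (Ici 1)
  cont : ContinuousOn m (Ici 1)
  piecewise : ∃ a : ℕ → ℝ, a 0 = 1 ∧ StrictMono a ∧ Tendsto a atTop atTop ∧
    ∀ i, ContDiffOn ℝ 1 m (Icc (a i) (a (i + 1)))
  interp : ∀ k : ℕ, 1 ≤ k → m k = μ k

/-- The derivative of a piecewise `C^1` function on `[1, ∞)`: the left derivative at `s > 1`
(which is the derivative wherever that exists), the right derivative at the end point `s = 1`. -/
def sidedDeriv (m : ℝ → ℝ) (s : ℝ) : ℝ :=
  if s = 1 then derivWithin m (Ici 1) 1 else derivWithin m (Iic s) s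

/-- `γ_m(n) = sup_{1 ≤ s ≤ n} s m'(s) / m(s)`. -/
def gammaSup (m : ℝ → ℝ) (n : ℕ) : ℝ :=
  sSup ((fun s : ℝ => s * sidedDeriv m s / m s) '' Icc 1 (n : ℝ))

/-- `Γ_m(n) = 4 e^{4 + γ_m(n)}`. -/
def bigGamma (m : ℝ → ℝ) (n : ℕ) : ℝ := 4 * Real.exp (4 + gammaSup m n)

/-- `C_N = Γ_m(2 (N - 1))`, to be used for `N ≥ 2`. -/
def remezConst (m : ℝ → ℝ) (N : ℕ) : ℝ := bigGamma m (2 * (N - 1))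

/-! ### Mean oscillation -/

/-- The mean oscillation `|B|⁻¹ ∫_B |g - g_B|`, where `g_B = |B|⁻¹ ∫_B g`. -/
def meanOscillation {d : ℕ} (g : EuclideanSpace ℝ (Fin d) → ℝ)
    (B : Set (EuclideanSpace ℝ (Fin d))) : ℝ :=
  ⨍ x in B, |g x - ⨍ y in B, g y|

end

/-! Write `n = N - 1`, `M = ‖f‖_K` and `δ` for the diameter of `K`. Everything rests on a Remez
inequality (`volume_sublevel_le`): the set where `|f| ≤ M e^{-2nu}` on `K` has measure at most `C_N
d |K| e^{-u}`. Hence `log M - log |f|` is non-negative with an exponential tail on `B`. Integrating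
the tail bounds its mean by `2n (Λ + 1)`, where `Λ = log (C_N d |K| / |B|)`, and the mean
oscillation is at most twice the mean distance to the constant `log M`.

The Remez inequality is reduced to segments issuing from a point where `|f| = M`: by Fubini
(`measure_mul_le_of_ray_le`), a bound for the proportion of each segment bounds the measure. Along a
segment inside `K`, the derivatives `φ_j` of `f` satisfy `|φ_j| ≤ M ∏ δ μ_i`, and `|φ_0(0)| = M`. If
`φ_0` were tiny on too large a set, that set would contain `n + 1` well separated points. The
polynomial of degree at most `n` interpolating `φ_0` there is small together with its derivatives,
and iterated Rolle yields points `x_0 < ⋯ < x_n` at which `φ_j` coincides with the `j`-th derivative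
of the polynomial. Bang's estimate `abs_lt_of_small_derivs` then gives `|φ_0(0)| < M`, a
contradiction.

The choice of `N` enters twice. The sum of `1 / (δ μ_j)` up to `N` is at least `e`, as Bang's
estimate requires. The sum up to `n` is below `e`, so `n ≤ e δ μ_n`; with the growth bound for the
interpolant, this makes the products of weights large enough to absorb the factor `n ^ j` lost in
differentiating the polynomial. -/

/-! ### Bang's estimate -/

/-- Bang's estimate: a function that has size `M` at `0` cannot have its successive derivatives
too small at an increasing sequence of points of `[0, 1)`. -/
theorem abs_lt_of_small_derivs {N : ℕ} {ν : ℕ → ℝ} {M : ℝ} (hM : 0 < M)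
    (hpos : ∀ j, 1 ≤ j → 0 < ν j) (hmono : ∀ j, 1 ≤ j → ν j ≤ ν (j + 1))
    {φ : ℕ → ℝ → ℝ}
    (hφ : ∀ i < N, ∀ x ∈ Icc (0 : ℝ) 1, HasDerivAt (φ i) (φ (i + 1) x) x)
    (hbd : ∀ i ≤ N, ∀ x ∈ Icc (0 : ℝ) 1, |φ i x| ≤ M * ∏ j ∈ Finset.Icc 1 i, ν j)
    (hsum : Real.exp 1 ≤ ∑ j ∈ Finset.Icc 1 N, 1 / ν j)
    {X : ℝ} (hX0 : 0 ≤ X) (hX1 : X < 1) {x : ℕ → ℝ} (hx : ∀ i < N, x i ∈ Icc 0 X)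
    (hxmono : ∀ i, i + 1 < N → x i ≤ x (i + 1))
    (hsmall : ∀ i < N, |φ i (x i)| ≤
      Real.exp ((i : ℝ) - N) * (M * ∏ j ∈ Finset.Icc 1 i, ν j)) :
    |φ 0 0| < M := by
  set P : ℕ → ℝ := fun i => M * ∏ j ∈ Finset.Icc 1 i, ν j with hP
  have hPpos : ∀ i, 0 < P i := fun i =>
    mul_pos hM (Finset.prod_pos fun j hj => hpos j (Finset.mem_Icc.1 hj).1)
  have hPs : ∀ i, P (i + 1) = P i * ν (i + 1) := fun i => by
    simp only [hP]
    rw [Finset.prod_Icc_succ_top (by omega)]; ring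
  have hmon : ∀ i k, 1 ≤ i → i ≤ k → ν i ≤ ν k := by
    intro i k hi hik
    induction k, hik using Nat.le_induction with
    | base => exact le_rfl
    | succ k hk ih => exact ih.trans (hmono k (hi.trans hk))
  -- Breakpoints `0 = a N ≤ ⋯ ≤ a 0`, with `a 0 ≥ 1` by `hsum`.
  set a : ℕ → ℝ := fun k => (∑ j ∈ Finset.Icc (k + 1) N, 1 / ν j) / Real.exp 1 with ha
  have hastep : ∀ k < N, a k = a (k + 1) + 1 / (Real.exp 1 * ν (k + 1)) := by
    intro k hk
    simp only [ha]
    rw [← Finset.add_sum_Ioc_eq_sum_Icc (by omega : k + 1 ≤ N)]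
    have : Finset.Ioc (k + 1) N = Finset.Icc (k + 1 + 1) N := by
      ext j; simp
    rw [this]
    have := (hpos (k + 1) (by omega)).ne'
    have := Real.exp_pos 1
    field_simp
    ring
  have haN : a N = 0 := by simp [ha]
  have ha0 : 1 ≤ a 0 := by
    simp only [ha]
    rw [le_div_iff₀ (Real.exp_pos 1)]
    simpa using hsum
  set L : ℕ → ℝ → ℝ := fun k s => -((k : ℝ) + 1) + Real.exp 1 * ν (k + 1) * (s - a (k + 1)) with hL
  have hLend : ∀ k < N, L k (a k) = -k := by
    intro k hk
    simp only [hL]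
    rw [hastep k hk]
    have := (hpos (k + 1) (by omega)).ne'
    have := Real.exp_pos 1
    field_simp
    ring
  have hale : ∀ k < N, a (k + 1) ≤ a k := by
    intro k hk
    rw [hastep k hk]
    have := hpos (k + 1) (by omega)
    have : 0 < 1 / (Real.exp 1 * ν (k + 1)) := by positivity
    linarith
  have hLge : ∀ k s, a (k + 1) ≤ s → -((k : ℝ) + 1) ≤ L k s := by
    intro k s hs
    have := hpos (k + 1) (by omega)
    have : 0 ≤ Real.exp 1 * ν (k + 1) * (s - a (k + 1)) :=
      mul_nonneg (by positivity) (by linarith)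
    simp only [hL]; linarith
  -- Downward induction on the order `i = N - c` of the derivative, moving left from `x i`.
  have key : ∀ c : ℕ, ∀ i, i + c = N → ∀ s, (i < N → X - x i ≤ s) → 0 ≤ s → s ≤ X →
      ∀ k < N, a (k + 1) ≤ s → s ≤ a k → |φ i (X - s)| ≤ P i * Real.exp (i + L k s) := by
    -- On pieces with `k < i` the exponent is non-negative, so the a priori bound `hbd` suffices.
    have triv : ∀ i ≤ N, ∀ s, 0 ≤ s → s ≤ X → ∀ k < i, a (k + 1) ≤ s →
        |φ i (X - s)| ≤ P i * Real.exp (i + L k s) := by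
      intro i hi s hs0 hsX k hk hks
      refine (hbd i hi _ ⟨by linarith, by linarith⟩).trans ?_
      have h1 : (k : ℝ) + 1 ≤ i := by exact_mod_cast hk
      have h2 := hLge k s hks
      have h3 : 1 ≤ Real.exp (i + L k s) := Real.one_le_exp (by linarith)
      exact le_mul_of_one_le_right (hPpos i).le h3
    intro c
    induction c with
    | zero =>
      intro i hi s _ hs0 hsX k hk hks _
      exact triv i (by omega) s hs0 hsX k (by omega) hks
    | succ c ih =>
      intro i hi
      have hiN : i < N := by omega
      have hXi : 0 ≤ X - x i := by linarith [(hx i hiN).2]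
      have step : ∀ k < N, ∀ σ s, X - x i ≤ σ → a (k + 1) ≤ σ → σ ≤ s → s ≤ X → s ≤ a k →
          |φ i (X - σ)| ≤ P i * Real.exp (i + L k σ) →
          |φ i (X - s)| ≤ P i * Real.exp (i + L k s) := by
        intro k hk σ s hσ hkσ hσs hsX hsk h0
        by_cases hki : k < i
        · exact triv i hiN.le s (by linarith) hsX k hki (by linarith)
        have hder : ∀ r ∈ Icc σ s, HasDerivAt (fun r => φ i (X - r)) (-φ (i + 1) (X - r)) r := by
          intro r hr
          have h1 := hφ i hiN (X - r) ⟨by linarith [hr.2], by linarith [hr.1]⟩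
          have h2 : HasDerivAt (fun r => X - r) (-1) r := by
            simpa using (hasDerivAt_id r).const_sub X
          simpa [Function.comp_def] using h1.comp r h2
        refine image_norm_le_of_norm_deriv_right_le_deriv_boundary
          (f := fun r => φ i (X - r)) (f' := fun r => -φ (i + 1) (X - r)) (a := σ) (b := s)
          (B := fun r => P i * Real.exp (i + L k r))
          (B' := fun r => P i * (Real.exp (i + L k r) * (Real.exp 1 * ν (k + 1))))
          (fun r hr => (hder r hr).continuousAt.continuousWithinAt)
          (fun r hr => (hder r (Ico_subset_Icc_self hr)).hasDerivWithinAt) h0 ?_ ?_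
          (right_mem_Icc.2 hσs)
        · intro r
          have h1 : HasDerivAt (fun r => (i : ℝ) + L k r) (Real.exp 1 * ν (k + 1)) r := by
            simp only [hL]
            simpa using ((((hasDerivAt_id r).sub_const (a (k + 1))).const_mul
              (Real.exp 1 * ν (k + 1))).const_add (-((k : ℝ) + 1))).const_add (i : ℝ)
          exact h1.exp.const_mul (P i)
        · intro r hr
          -- The bound for `φ (i + 1)` holds to the left of `x (i + 1)`, hence to the left of `x i`.
          have h1 : |φ (i + 1) (X - r)| ≤ P (i + 1) * Real.exp ((i + 1 : ℕ) + L k r) := by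
            refine ih (i + 1) (by omega) r (fun h => ?_) (by linarith [hr.1])
              (by linarith [hr.2]) k hk (by linarith [hr.1]) (by linarith [hr.2])
            linarith [hr.1, hxmono i h]
          rw [norm_neg, Real.norm_eq_abs]
          refine h1.trans ?_
          rw [hPs, show ((i + 1 : ℕ) : ℝ) + L k r = (i + L k r) + 1 by push_cast; ring,
            Real.exp_add, mul_assoc]
          refine mul_le_mul_of_nonneg_left ?_ (hPpos i).le
          -- Monotonicity of the weight makes the slope `e ν (k + 1)` of the exponent sufficient,
          -- since `i ≤ k`.
          have h2 := hmon (i + 1) (k + 1) (by omega) (by omega)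
          have h3 := Real.exp_pos (i + L k r)
          have h4 := Real.exp_pos 1
          calc ν (i + 1) * (Real.exp (i + L k r) * Real.exp 1)
              ≤ ν (k + 1) * (Real.exp (i + L k r) * Real.exp 1) :=
                mul_le_mul_of_nonneg_right h2 (by positivity)
            _ = _ := by ring
      have first : ∀ k < N, a (k + 1) ≤ X - x i → ∀ s, X - x i ≤ s → s ≤ X → s ≤ a k →
          |φ i (X - s)| ≤ P i * Real.exp (i + L k s) := by
        intro k hk hka s hs hsX hsk
        refine step k hk (X - x i) s le_rfl hka hs hsX hsk ?_
        rw [sub_sub_cancel]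
        refine (hsmall i hiN).trans ?_
        rw [mul_comm]
        refine mul_le_mul_of_nonneg_left (Real.exp_le_exp.2 ?_) (hPpos i).le
        have := hLge k _ hka
        have : (k : ℝ) + 1 ≤ N := by exact_mod_cast hk
        linarith
      -- Runs through the pieces from `k = N - 1` down. A piece is entered either at `X - x i`, by
      -- `hsmall`, or at its left end, by the previous piece.
      have inner : ∀ e k, k + e + 1 = N → ∀ s, X - x i ≤ s → s ≤ X →
          a (k + 1) ≤ s → s ≤ a k → |φ i (X - s)| ≤ P i * Real.exp (i + L k s) := by
        intro e
        induction e with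
        | zero =>
          intro k hk s hs hsX hks hsk
          have : a (k + 1) = 0 := by rw [show k + 1 = N by omega, haN]
          exact first k (by omega) (by linarith) s hs hsX hsk
        | succ e ihe =>
          intro k hk s hs hsX hks hsk
          rcases le_total (a (k + 1)) (X - x i) with h | h
          · exact first k (by omega) h s hs hsX hsk
          · have h1 := ihe (k + 1) (by omega) (a (k + 1)) h (by linarith)
              (hale (k + 1) (by omega)) le_rfl
            rw [hLend (k + 1) (by omega)] at h1
            refine step k (by omega) (a (k + 1)) s h le_rfl hks hsX hsk ?_
            simpa [hL] using h1
      intro s hs hs0 hsX k hk hks hsk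
      exact inner (N - 1 - k) k (by omega) s (hs hiN) hsX hks hsk
  have hex : ∃ k, k < N ∧ a (k + 1) ≤ X ∧ X < a k := by
    by_contra! hcon
    have : ∀ k ≤ N, X < a k := by
      intro k
      induction k with
      | zero => intro _; linarith
      | succ k ih =>
        intro hk
        by_contra! h
        exact absurd (ih (by omega)) (not_lt.2 (hcon k (by omega) h))
    linarith [this N le_rfl]
  obtain ⟨k, hk, hk1, hk2⟩ := hex
  have h := key N 0 (by omega) X (fun h0 => by linarith [(hx 0 h0).1]) hX0 le_rfl k hk hk1 hk2.le
  -- Since `X < 1 ≤ a 0`, the exponent at `s = X` is still strictly negative.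
  have hlt : L k X < L k (a k) := by
    have := hpos (k + 1) (by omega)
    simp only [hL]
    have : Real.exp 1 * ν (k + 1) * (X - a (k + 1)) < Real.exp 1 * ν (k + 1) * (a k - a (k + 1)) :=
      mul_lt_mul_of_pos_left (by linarith) (by positivity)
    linarith
  rw [hLend k hk] at hlt
  have hk0 : (0 : ℝ) ≤ k := k.cast_nonneg
  have h2 : Real.exp (((0 : ℕ) : ℝ) + L k X) < 1 := by
    rw [Real.exp_lt_one_iff]; push_cast; linarith
  have h3 : P 0 = M := by simp [hP]
  rw [sub_self, h3] at h
  nlinarith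

/-! ### Separated points, iterated Rolle, interpolation -/

/-- A set of reals of outer measure more than `2 n g` contains `n + 1` points with gaps at least
`g`. -/
theorem exists_separated_points {g : ℝ} (hg : 0 < g) (n : ℕ) :
    ∀ A : Set ℝ, BddBelow A → ENNReal.ofReal (2 * n * g) < volume A →
      ∃ t : ℕ → ℝ, (∀ i ≤ n, t i ∈ A) ∧ ∀ i < n, t i + g ≤ t (i + 1) := by
  induction n with
  | zero =>
    intro A _ hA
    obtain ⟨x, hx⟩ := nonempty_of_measure_ne_zero (ne_bot_of_gt hA)
    exact ⟨fun _ => x, fun _ _ => hx, fun i hi => absurd hi (Nat.not_lt_zero i)⟩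
  | succ n ih =>
    intro A hb hA
    have hne := nonempty_of_measure_ne_zero (ne_bot_of_gt hA)
    -- The infimum need not be attained: a point within `g` of it is taken. Discarding everything up
    -- to `x + g` then costs at most `2g`.
    obtain ⟨x, hx, hxlt⟩ := exists_lt_of_csInf_lt hne (lt_add_of_pos_right (sInf A) hg)
    have hsub : A ⊆ Icc (sInf A) (x + g) ∪ (A ∩ Ici (x + g)) := by
      intro y hy
      rcases le_total y (x + g) with h | h
      · exact Or.inl ⟨csInf_le hb hy, h⟩
      · exact Or.inr ⟨hy, h⟩
    have hA' : ENNReal.ofReal (2 * n * g) < volume (A ∩ Ici (x + g)) := by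
      by_contra! h
      refine absurd hA (not_lt.2 ?_)
      refine (measure_mono hsub).trans ((measure_union_le _ _).trans ?_)
      rw [Real.volume_Icc]
      refine (add_le_add_right h _).trans ?_
      rw [← ENNReal.ofReal_add (by linarith [csInf_le hb hx]) (by positivity)]
      apply ENNReal.ofReal_le_ofReal
      push_cast
      linarith
    obtain ⟨t, ht, htg⟩ := ih _ (hb.mono inter_subset_left) hA'
    refine ⟨fun i => Nat.casesOn i x t, ?_, ?_⟩
    · intro i hi
      cases i with
      | zero => exact hx
      | succ i => exact (ht i (by omega)).1
    · intro i hi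
      cases i with
      | zero => exact (ht 0 (by omega)).2
      | succ i => exact htg i (by omega)

theorem mul_sub_le_sub_of_gaps {g : ℝ} {n : ℕ} {t : ℕ → ℝ}
    (ht : ∀ i < n, t i + g ≤ t (i + 1)) {i k : ℕ} (hik : i ≤ k) (hk : k ≤ n) :
    g * ((k : ℝ) - i) ≤ t k - t i := by
  induction k, hik using Nat.le_induction with
  | base => simp
  | succ k hik ih =>
    have h1 := ih (by omega)
    have h2 := ht k (by omega)
    push_cast
    linarith

/-- Iterated Rolle: the successive derivatives of a function with `n + 1` zeros vanish at an
increasing sequence of points. -/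
theorem exists_increasing_zeros_of_derivs {n : ℕ} {h : ℕ → ℝ → ℝ} {t : ℕ → ℝ}
    (ht : ∀ i < n, t i < t (i + 1)) (hz : ∀ i ≤ n, h 0 (t i) = 0)
    (hh : ∀ j < n, ∀ x ∈ Icc (t 0) (t n), HasDerivAt (h j) (h (j + 1) x) x) :
    ∃ x : ℕ → ℝ, x 0 = t 0 ∧ (∀ j ≤ n, x j ∈ Icc (t 0) (t n) ∧ h j (x j) = 0) ∧
      (∀ j < n, x j < x (j + 1)) ∧ (1 ≤ n → x n < t n) := by
  induction n generalizing h t with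
  | zero =>
    refine ⟨fun _ => t 0, rfl, ?_, by simp, by simp⟩
    intro j hj
    obtain rfl : j = 0 := by omega
    exact ⟨by simp, hz 0 le_rfl⟩
  | succ n ih =>
    have hmono : ∀ i k, i ≤ k → k ≤ n + 1 → t i ≤ t k := by
      intro i k hik hk
      induction k, hik using Nat.le_induction with
      | base => exact le_rfl
      | succ k hik ih => exact (ih (by omega)).trans (ht k (by omega)).le
    have hr : ∀ i, ∃ c, i ≤ n → c ∈ Ioo (t i) (t (i + 1)) ∧ h 1 c = 0 := by
      intro i
      by_cases hi : i ≤ n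
      · have hsub : Icc (t i) (t (i + 1)) ⊆ Icc (t 0) (t (n + 1)) :=
          Icc_subset_Icc (hmono 0 i (by omega) (by omega)) (hmono (i + 1) (n + 1) (by omega) le_rfl)
        obtain ⟨c, hc, hc0⟩ := exists_hasDerivAt_eq_zero (ht i (by omega))
          (fun x hx => (hh 0 (by omega) x (hsub hx)).continuousAt.continuousWithinAt)
          (by rw [hz i (by omega), hz (i + 1) (by omega)])
          (fun x hx => hh 0 (by omega) x (hsub (Ioo_subset_Icc_self hx)))
        exact ⟨c, fun _ => ⟨hc, hc0⟩⟩
      · exact ⟨0, fun h => absurd h hi⟩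
    choose c hc using hr
    have hc0 := (hc 0 (by omega)).1
    have hcn := (hc n le_rfl).1
    have hsub : Icc (c 0) (c n) ⊆ Icc (t 0) (t (n + 1)) := Icc_subset_Icc hc0.1.le hcn.2.le
    obtain ⟨x, hx0, hxz, hxm, -⟩ := ih (h := fun j => h (j + 1)) (t := c)
      (fun i hi => (hc i (by omega)).1.2.trans (hc (i + 1) (by omega)).1.1)
      (fun i hi => (hc i hi).2) (fun j hj y hy => hh (j + 1) (by omega) y (hsub hy))
    -- The sequence for the derivative starts at `c 0 > t 0`, so `t 0` can be prepended.
    refine ⟨fun j => Nat.casesOn j (t 0) x, rfl, ?_, ?_, ?_⟩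
    · intro j hj
      cases j with
      | zero => exact ⟨⟨le_rfl, hmono 0 _ (by omega) le_rfl⟩, hz 0 (by omega)⟩
      | succ j => exact ⟨hsub (hxz j (by omega)).1, (hxz j (by omega)).2⟩
    · intro j hj
      cases j with
      | zero =>
        change t 0 < x 0
        rw [hx0]; exact hc0.1
      | succ j => exact hxm j (by omega)
    · intro _
      exact (hxz n le_rfl).1.2.trans_lt hcn.2

-- By the product rule each differentiation gives at most `S.card` products of the same kind with
-- one factor fewer, and every factor is at most `1` in absolute value at `x`.
open Polynomial in
theorem abs_eval_iterate_derivative_prod_le {ι : Type*} [DecidableEq ι] (t : ι → ℝ) {x : ℝ} (j : ℕ) :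
    ∀ S : Finset ι, (∀ k ∈ S, |x - t k| ≤ 1) →
      |(derivative^[j] (∏ k ∈ S, (X - C (t k)))).eval x| ≤ (S.card : ℝ) ^ j := by
  induction j with
  | zero =>
    intro S hS
    simp only [Function.iterate_zero, id, eval_prod, eval_sub, eval_X, eval_C, pow_zero,
      Finset.abs_prod]
    exact Finset.prod_le_one (fun _ _ => abs_nonneg _) hS
  | succ j ih =>
    intro S hS
    rw [Function.iterate_succ_apply, derivative_prod_finset, iterate_derivative_sum, eval_finsetSum]
    refine (Finset.abs_sum_le_sum_abs _ _).trans ?_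
    have : ∀ a ∈ S, |(derivative^[j] ((∏ b ∈ S.erase a, (X - C (t b))) *
        derivative (X - C (t a)))).eval x| ≤ (S.card : ℝ) ^ j := by
      intro a ha
      simp only [derivative_sub, derivative_X, derivative_C, sub_zero, mul_one]
      refine (ih _ fun k hk => hS k (Finset.mem_of_mem_erase hk)).trans ?_
      gcongr
      exact Finset.erase_subset _ _
    refine (Finset.sum_le_sum this).trans ?_
    rw [Finset.sum_const, nsmul_eq_mul, pow_succ']

theorem prod_abs_sub_erase (n : ℕ) {i : ℕ} (hi : i ≤ n) :
    ∏ k ∈ (Finset.range (n + 1)).erase i, |(i : ℝ) - k| = i.factorial * (n - i).factorial := by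
  have hs : (Finset.range (n + 1)).erase i = Finset.range i ∪ Finset.Ico (i + 1) (n + 1) := by
    ext k; simp; omega
  have hd : Disjoint (Finset.range i) (Finset.Ico (i + 1) (n + 1)) := by
    rw [Finset.disjoint_left]; intro k; simp; omega
  rw [hs, Finset.prod_union hd]
  congr 1
  · rw [← Finset.prod_range_reflect, ← Finset.prod_range_add_one_eq_factorial]
    push_cast
    refine Finset.prod_congr rfl fun k hk => ?_
    have := Finset.mem_range.1 hk
    rw [Nat.cast_sub (by omega), Nat.cast_sub (by omega)]
    push_cast
    rw [abs_of_nonneg] <;> [ring; (ring_nf; positivity)]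
  · rw [Finset.prod_Ico_eq_prod_range, ← Finset.prod_range_add_one_eq_factorial]
    rw [show n + 1 - (i + 1) = n - i by omega]
    push_cast
    refine Finset.prod_congr rfl fun k hk => ?_
    rw [abs_of_nonpos] <;> [ring; (ring_nf; linarith [(k.cast_nonneg : (0:ℝ) ≤ k)])]

open Polynomial in
/-- Bounds for the derivatives on `[0, 1]` of a polynomial of degree `n` that is at most `ε` at
`n + 1` points with gaps at least `g`. -/
theorem abs_eval_iterate_derivative_interpolate_le {n : ℕ} {g ε : ℝ} (hg : 0 < g) (hε : 0 ≤ ε)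
    {t r : ℕ → ℝ} (ht : ∀ i ≤ n, t i ∈ Icc (0 : ℝ) 1) (htg : ∀ i < n, t i + g ≤ t (i + 1))
    (hr : ∀ i ≤ n, |r i| ≤ ε) {x : ℝ} (hx : x ∈ Icc (0 : ℝ) 1) (j : ℕ) :
    |(derivative^[j] (Lagrange.interpolate (Finset.range (n + 1)) t r)).eval x| ≤
      ε * n ^ j * (2 ^ n / (g ^ n * n.factorial)) := by
  rw [Lagrange.interpolate_apply, iterate_derivative_sum, eval_finsetSum]
  refine (Finset.abs_sum_le_sum_abs _ _).trans ?_
  have hterm : ∀ i ∈ Finset.range (n + 1),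
      |(derivative^[j] (C (r i) * Lagrange.basis (Finset.range (n + 1)) t i)).eval x| ≤
        ε * n ^ j * ((n.choose i : ℝ) / (g ^ n * n.factorial)) := by
    intro i hi
    have hin : i ≤ n := Nat.lt_succ_iff.1 (Finset.mem_range.1 hi)
    have hb : Lagrange.basis (Finset.range (n + 1)) t i =
        C (∏ k ∈ (Finset.range (n + 1)).erase i, (t i - t k)⁻¹) *
          ∏ k ∈ (Finset.range (n + 1)).erase i, (X - C (t k)) := by
      simp only [Lagrange.basis, Lagrange.basisDivisor, Finset.prod_mul_distrib, map_prod]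
    have hcard : ((Finset.range (n + 1)).erase i).card = n := by
      rw [Finset.card_erase_of_mem hi, Finset.card_range]; rfl
    have h1 := abs_eval_iterate_derivative_prod_le t (x := x) j ((Finset.range (n + 1)).erase i) (by
      intro k hk
      have := ht k (Nat.lt_succ_iff.1 (Finset.mem_range.1 (Finset.mem_of_mem_erase hk)))
      rw [abs_le]
      constructor <;> linarith [this.1, this.2, hx.1, hx.2])
    rw [hcard] at h1
    have h2 : |∏ k ∈ (Finset.range (n + 1)).erase i, (t i - t k)⁻¹| ≤
        (n.choose i : ℝ) / (g ^ n * n.factorial) := by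
      -- The gaps give `|t i - t k| ≥ g |i - k|`; the resulting factorials turn the sum over `i`
      -- into a sum of binomial coefficients.
      have h3 : g ^ n * (i.factorial * (n - i).factorial) ≤
          ∏ k ∈ (Finset.range (n + 1)).erase i, |t i - t k| := by
        have : g ^ n * (i.factorial * (n - i).factorial : ℝ) =
            ∏ k ∈ (Finset.range (n + 1)).erase i, (g * |(i : ℝ) - k|) := by
          rw [Finset.prod_mul_distrib, prod_abs_sub_erase n hin, Finset.prod_const, hcard]
        rw [this]
        refine Finset.prod_le_prod (fun k _ => by positivity) fun k hk => ?_
        have hk' : k ≤ n :=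
          Nat.lt_succ_iff.1 (Finset.mem_range.1 (Finset.mem_of_mem_erase hk))
        rcases le_total i k with h | h
        · have := mul_sub_le_sub_of_gaps htg h hk'
          rw [abs_sub_comm, abs_sub_comm (t i), abs_of_nonneg (by simpa using h)]
          exact this.trans (le_abs_self _)
        · have := mul_sub_le_sub_of_gaps htg h hin
          rw [abs_of_nonneg (by simpa using h)]
          exact this.trans (le_abs_self _)
      rw [Finset.prod_inv_distrib, abs_inv, Finset.abs_prod]
      have h4 : (0 : ℝ) < g ^ n * (i.factorial * (n - i).factorial) := by positivity
      refine (inv_anti₀ h4 h3).trans (le_of_eq ?_)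
      rw [Nat.choose_eq_factorial_div_factorial hin,
        Nat.cast_div (Nat.factorial_mul_factorial_dvd_factorial hin) (by positivity)]
      push_cast
      field_simp
    rw [hb, iterate_derivative_C_mul, iterate_derivative_C_mul, eval_mul, eval_mul, eval_C, eval_C,
      abs_mul, abs_mul, mul_assoc ε]
    refine mul_le_mul (hr i hin) ?_ (by positivity) hε
    rw [mul_comm]
    exact mul_le_mul h1 h2 (abs_nonneg _) (by positivity)
  refine (Finset.sum_le_sum hterm).trans (le_of_eq ?_)
  rw [← Finset.mul_sum, ← Finset.sum_div]
  congr 2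
  exact_mod_cast Nat.sum_range_choose n

/-! ### The Remez inequality on an interval -/

/-- One-dimensional Remez type inequality for smooth functions whose derivatives are controlled by
a weight. -/
theorem volume_le_of_abs_le {n : ℕ} (hn : 1 ≤ n) {ν : ℕ → ℝ} {M γ : ℝ} (hM : 0 < M) (hγ : 0 ≤ γ)
    (hpos : ∀ j, 1 ≤ j → 0 < ν j) (hmono : ∀ j, 1 ≤ j → ν j ≤ ν (j + 1))
    (hsum : Real.exp 1 ≤ ∑ j ∈ Finset.Icc 1 (n + 1), 1 / ν j)
    (hlow : ∀ j ≤ n, (n : ℝ) ^ j ≤ Real.exp (j + n * γ) * ∏ i ∈ Finset.Icc 1 j, ν i)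
    {φ : ℕ → ℝ → ℝ}
    (hφ : ∀ i < n + 1, ∀ x ∈ Icc (0 : ℝ) 1, HasDerivAt (φ i) (φ (i + 1) x) x)
    (hbd : ∀ i ≤ n + 1, ∀ x ∈ Icc (0 : ℝ) 1, |φ i x| ≤ M * ∏ j ∈ Finset.Icc 1 i, ν j)
    (hmax : |φ 0 0| = M) {u : ℝ} {A : Set ℝ} (hA01 : A ⊆ Icc 0 1)
    (hA : ∀ r ∈ A, |φ 0 r| ≤ M * Real.exp (-(2 * n * u))) :
    volume A ≤ ENNReal.ofReal (2 * Real.exp (2 + γ) * Real.exp (-u)) := by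
  by_contra! hlt
  set lam := 2 * Real.exp (2 + γ) * Real.exp (-u) with hlam
  have hlam0 : 0 < lam := by positivity
  have hlam1 : lam < 1 := by
    have := hlt.trans_le (measure_mono hA01)
    rw [Real.volume_Icc, ENNReal.ofReal_lt_ofReal_iff_of_nonneg hlam0.le] at this
    linarith
  have hn0 : (0 : ℝ) < n := by exact_mod_cast hn
  have hn1 : (1 : ℝ) ≤ n := by exact_mod_cast hn
  set g := lam / (2 * n) with hg
  have hg0 : 0 < g := by positivity
  obtain ⟨t, htA, htg⟩ := exists_separated_points hg0 n A (bddBelow_Icc.mono hA01)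
    (by rwa [show 2 * (n : ℝ) * g = lam by rw [hg]; field_simp])
  have ht01 : ∀ i ≤ n, t i ∈ Icc (0 : ℝ) 1 := fun i hi => hA01 (htA i hi)
  have htlt : ∀ i < n, t i < t (i + 1) := fun i hi => by linarith [htg i hi]
  have htinj : Set.InjOn t (Finset.range (n + 1) : Finset ℕ) := by
    have : ∀ i k, i < k → k ≤ n → t i ≠ t k := by
      intro i k hik hk
      have h1 := mul_sub_le_sub_of_gaps htg hik.le hk
      have h2 : (0 : ℝ) < (k : ℝ) - i := by
        have : (i : ℝ) < k := by exact_mod_cast hik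
        linarith
      have := mul_pos hg0 h2
      intro h
      linarith
    intro i hi k hk hik
    simp only [Finset.coe_range, mem_Iio] at hi hk
    rcases lt_trichotomy i k with h | h | h
    · exact absurd hik (this i k h (by omega))
    · exact h
    · exact absurd hik.symm (this k i h (by omega))
  set p := Lagrange.interpolate (Finset.range (n + 1)) t (fun i => φ 0 (t i)) with hp
  have hsub : Icc (t 0) (t n) ⊆ Icc 0 1 :=
    Icc_subset_Icc (ht01 0 (by omega)).1 (ht01 n le_rfl).2
  -- Rolle for `φ 0 - p`, which vanishes at the `n + 1` nodes.
  obtain ⟨x, -, hxz, hxm, hxn⟩ := exists_increasing_zeros_of_derivs (n := n)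
    (h := fun j y => φ j y - (Polynomial.derivative^[j] p).eval y) htlt
    (fun i hi => by
      simp only [Function.iterate_zero, id]
      rw [hp, Lagrange.eval_interpolate_at_node _ htinj (Finset.mem_range.2 (by omega)), sub_self])
    (fun j hj y hy => by
      have h1 := (Polynomial.derivative^[j] p).hasDerivAt y
      rw [← Function.iterate_succ_apply' (f := Polynomial.derivative)] at h1
      exact (hφ j (by omega) y (hsub hy)).sub h1)
  have hxmono : ∀ i, i ≤ n → x i ≤ x n := by
    intro i hi
    induction hi using Nat.decreasingInduction with
    | self => exact le_rfl
    | of_succ k hk ih => exact (hxm k hk).le.trans ih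
  -- Here `e^{-2nu}` is `lam ^ (2n)` up to constants. One factor `lam ^ n` cancels the `g ^ n` in
  -- the denominator, the other is at most `1`; what remains is at most `e^{-3n}`, and `3n ≥ n + 1`.
  have hconst : Real.exp (-(2 * n * u)) * (2 ^ n / (g ^ n * n.factorial)) * Real.exp (n * γ) ≤
      Real.exp (-((n : ℝ) + 1)) := by
    have h1 : (n : ℝ) ^ n ≤ Real.exp n * n.factorial := by
      have := Real.pow_div_factorial_le_exp (x := n) hn0.le n
      rwa [div_le_iff₀ (by positivity)] at this
    have h2 : (2 : ℝ) ^ n / (g ^ n * n.factorial) = 4 ^ n * (n ^ n / n.factorial) / lam ^ n := by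
      rw [hg, div_pow, mul_pow, show (4 : ℝ) ^ n = 2 ^ n * 2 ^ n by rw [← mul_pow]; norm_num]
      field_simp
      rw [mul_pow]
    have h3 : (n : ℝ) ^ n / n.factorial ≤ Real.exp n := by
      rwa [div_le_iff₀ (by positivity)]
    have h4 : Real.exp (-(2 * n * u)) = (lam ^ n * lam ^ n) /
        (4 ^ n * Real.exp (n * (4 + 2 * γ))) := by
      have : lam ^ n * lam ^ n = (4 * Real.exp (4 + 2 * γ) * Real.exp (-(2 * u))) ^ n := by
        rw [← mul_pow, hlam]
        congr 1
        rw [show 4 + 2 * γ = (2 + γ) + (2 + γ) by ring, Real.exp_add (2 + γ),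
          show -(2 * u) = -u + -u by ring, Real.exp_add (-u)]
        ring
      rw [this, mul_pow, mul_pow, ← Real.exp_nat_mul, ← Real.exp_nat_mul]
      rw [mul_div_cancel_left₀ _ (by positivity)]
      congr 1; ring
    have h5 : lam ^ n ≤ 1 := pow_le_one₀ hlam0.le hlam1.le
    rw [h2, h4]
    calc _ = lam ^ n * ((n : ℝ) ^ n / n.factorial) *
          (Real.exp (n * γ) / Real.exp (n * (4 + 2 * γ))) := by field_simp
      _ ≤ 1 * Real.exp n * (Real.exp (n * γ) / Real.exp (n * (4 + 2 * γ))) := by gcongr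
      _ = Real.exp (n + (n * γ - n * (4 + 2 * γ))) := by
        rw [one_mul, ← Real.exp_sub, ← Real.exp_add]
      _ ≤ _ := Real.exp_le_exp.2 (by nlinarith [mul_nonneg hn0.le hγ])
  -- Bang's estimate with `n + 1` for `N` and `X = x n`; since `n ≥ 1`, Rolle gives `x n < t n ≤ 1`.
  refine (abs_lt_of_small_derivs hM hpos hmono hφ hbd hsum
    (hsub (hxz n le_rfl).1).1 ((hxn hn).trans_le (ht01 n le_rfl).2) (x := x)
    (fun i hi => ⟨(hsub (hxz i (by omega)).1).1, hxmono i (by omega)⟩)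
    (fun i hi => (hxm i (by omega)).le) ?_).ne hmax
  intro j hj
  rw [sub_eq_zero.1 (hxz j (by omega)).2]
  refine (abs_eval_iterate_derivative_interpolate_le hg0
    (ε := M * Real.exp (-(2 * n * u))) (by positivity) ht01 htg (fun i hi => hA _ (htA i hi))
    (hsub (hxz j (by omega)).1) j).trans ?_
  have h1 := hlow j (by omega)
  have hQ : 0 < ∏ i ∈ Finset.Icc 1 j, ν i :=
    Finset.prod_pos fun i hi => hpos i (Finset.mem_Icc.1 hi).1
  calc M * Real.exp (-(2 * n * u)) * n ^ j * (2 ^ n / (g ^ n * n.factorial))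
      ≤ M * Real.exp (-(2 * n * u)) * (Real.exp (j + n * γ) * ∏ i ∈ Finset.Icc 1 j, ν i) *
          (2 ^ n / (g ^ n * n.factorial)) := by gcongr
    _ = (Real.exp (-(2 * n * u)) * (2 ^ n / (g ^ n * n.factorial)) * Real.exp (n * γ)) *
          (Real.exp j * (M * ∏ i ∈ Finset.Icc 1 j, ν i)) := by rw [Real.exp_add]; ring
    _ ≤ Real.exp (-((n : ℝ) + 1)) * (Real.exp j * (M * ∏ i ∈ Finset.Icc 1 j, ν i)) := by gcongr
    _ = _ := by
      rw [← mul_assoc, ← Real.exp_add]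
      congr 2
      push_cast; ring

/-! ### Derivatives along lines in terms of partial derivatives -/

section PartialDerivatives

variable {d : ℕ} {U : Set (EuclideanSpace ℝ (Fin d))}

theorem partialD_eqOn_fderiv (hU : IsOpen U) {k : ℕ} {f : EuclideanSpace ℝ (Fin d) → ℝ}
    (hf : ContDiffOn ℝ ((k + 1 : ℕ) : ℕ∞) f U) (i : Fin d) :
    EqOn (partialD i f) (fun x => fderiv ℝ f x (EuclideanSpace.single i 1)) U := fun x hx =>
  ((hf.contDiffAt (hU.mem_nhds hx)).differentiableAt (by simp)).lineDeriv_eq_fderiv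

theorem contDiffOn_partialD (hU : IsOpen U) {k : ℕ} {f : EuclideanSpace ℝ (Fin d) → ℝ}
    (hf : ContDiffOn ℝ ((k + 1 : ℕ) : ℕ∞) f U) (i : Fin d) :
    ContDiffOn ℝ (k : ℕ∞) (partialD i f) U := by
  refine ContDiffOn.congr ?_ (partialD_eqOn_fderiv hU hf i)
  exact (hf.fderiv_of_isOpen hU (m := (k : ℕ∞)) (by norm_cast)).clm_apply contDiffOn_const

theorem partialD_congr (hU : IsOpen U) {f g : EuclideanSpace ℝ (Fin d) → ℝ} (h : EqOn f g U)
    (i : Fin d) : EqOn (partialD i f) (partialD i g) U := fun _ hx =>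
  (h.eventuallyEq_of_mem (hU.mem_nhds hx)).lineDeriv_eq

theorem iterate_partialD_congr (hU : IsOpen U) {f g : EuclideanSpace ℝ (Fin d) → ℝ} (h : EqOn f g U)
    (i : Fin d) (k : ℕ) : EqOn ((partialD i)^[k] f) ((partialD i)^[k] g) U := by
  induction k with
  | zero => exact h
  | succ k ih =>
    rw [Function.iterate_succ_apply', Function.iterate_succ_apply']
    exact partialD_congr hU ih i

theorem contDiffOn_iterate_partialD (hU : IsOpen U) (i : Fin d) (a : ℕ) :
    ∀ {k : ℕ} {f : EuclideanSpace ℝ (Fin d) → ℝ}, ContDiffOn ℝ ((k + a : ℕ) : ℕ∞) f U →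
      ContDiffOn ℝ (k : ℕ∞) ((partialD i)^[a] f) U := by
  induction a with
  | zero => intro k f hf; exact hf
  | succ a ih =>
    intro k f hf
    rw [Function.iterate_succ_apply]
    exact ih (contDiffOn_partialD hU hf i)

theorem partialD_comm (hU : IsOpen U) {f : EuclideanSpace ℝ (Fin d) → ℝ}
    (hf : ContDiffOn ℝ ((2 : ℕ) : ℕ∞) f U) (i j : Fin d) :
    EqOn (partialD i (partialD j f)) (partialD j (partialD i f)) U := by
  have key : ∀ i j : Fin d, ∀ x ∈ U, partialD i (partialD j f) x =
      fderiv ℝ (fderiv ℝ f) x (EuclideanSpace.single i 1) (EuclideanSpace.single j 1) := by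
    intro i j x hx
    rw [partialD_congr hU (partialD_eqOn_fderiv hU (k := 1) hf j) i hx]
    have h1 : DifferentiableAt ℝ (fderiv ℝ f) x :=
      ((hf.fderiv_of_isOpen hU (m := ((1 : ℕ) : ℕ∞)) (by norm_cast)).contDiffAt
        (hU.mem_nhds hx)).differentiableAt (by simp)
    rw [partialD, DifferentiableAt.lineDeriv_eq_fderiv (h1.clm_apply (differentiableAt_const _)),
      fderiv_clm_apply h1 (differentiableAt_const _)]
    simp
  intro x hx
  rw [key i j x hx, key j i x hx]
  refine ContDiffAt.isSymmSndFDerivAt (n := 2) ?_ (by simp) _ _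
  exact_mod_cast hf.contDiffAt (hU.mem_nhds hx)

theorem partialD_iterate_comm (hU : IsOpen U) (i j : Fin d) (a : ℕ) :
    ∀ {f : EuclideanSpace ℝ (Fin d) → ℝ}, ContDiffOn ℝ ((a + 1 : ℕ) : ℕ∞) f U →
    EqOn (partialD i ((partialD j)^[a] f)) ((partialD j)^[a] (partialD i f)) U := by
  induction a with
  | zero => intro f _; exact fun _ _ => rfl
  | succ a ih =>
    intro f hf
    rw [Function.iterate_succ_apply, Function.iterate_succ_apply]
    refine (ih (contDiffOn_partialD hU hf j)).trans ?_
    refine iterate_partialD_congr hU (partialD_comm hU (hf.of_le ?_) i j) j a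
    exact_mod_cast (by omega : 2 ≤ a + 1 + 1)

theorem contDiffOn_foldr_partialD (hU : IsOpen U) (α : Fin d → ℕ)
    {f : EuclideanSpace ℝ (Fin d) → ℝ} (l : List (Fin d)) :
    ∀ {k : ℕ}, ContDiffOn ℝ ((k + (l.map α).sum : ℕ) : ℕ∞) f U →
      ContDiffOn ℝ (k : ℕ∞) (l.foldr (fun i g => (partialD i)^[α i] g) f) U := by
  induction l with
  | nil => intro k hf; simpa using hf
  | cons j l ih =>
    intro k hf
    rw [List.foldr_cons]
    refine contDiffOn_iterate_partialD hU j (α j) (ih ?_)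
    rw [List.map_cons, List.sum_cons] at hf
    rwa [add_assoc]

/-- By symmetry of second derivatives, `∂_i` moves past the other blocks until it meets its own,
which occurs only once because `l` has no duplicates. -/
theorem partialD_foldr (hU : IsOpen U) (α : Fin d → ℕ) (i : Fin d)
    {f : EuclideanSpace ℝ (Fin d) → ℝ} (l : List (Fin d)) (hl : l.Nodup) (hi : i ∈ l)
    (hf : ContDiffOn ℝ (((l.map α).sum + 1 : ℕ) : ℕ∞) f U) :
    EqOn (partialD i (l.foldr (fun i g => (partialD i)^[α i] g) f))
      (l.foldr (fun j g => (partialD j)^[(α + Pi.single i 1 : Fin d → ℕ) j] g) f) U := by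
  induction l with
  | nil => simp at hi
  | cons j l ih =>
    rw [List.nodup_cons] at hl
    rw [List.foldr_cons, List.foldr_cons]
    rw [List.map_cons, List.sum_cons] at hf
    by_cases hij : i = j
    · subst hij
      have h1 : l.foldr (fun j g => (partialD j)^[(α + Pi.single i 1 : Fin d → ℕ) j] g) f =
          l.foldr (fun j g => (partialD j)^[α j] g) f := by
        refine List.foldr_ext _ _ _ fun j hj g => ?_
        have : j ≠ i := fun h => hl.1 (h ▸ hj)
        simp [this]
      rw [h1]
      simp only [Pi.add_apply, Pi.single_eq_same, Function.iterate_succ_apply']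
      exact fun _ _ => rfl
    · have hil : i ∈ l := (List.mem_cons.1 hi).resolve_left hij
      have hji : j ≠ i := fun h => hij h.symm
      have h0 : (α + Pi.single i 1 : Fin d → ℕ) j = α j := by simp [hji]
      rw [h0]
      refine (partialD_iterate_comm hU i j (α j) ?_).trans
        (iterate_partialD_congr hU (ih hl.2 hil (hf.of_le ?_)) j (α j))
      · refine contDiffOn_foldr_partialD hU α l (hf.of_le ?_)
        exact_mod_cast (by omega)
      · exact_mod_cast (by omega)

theorem contDiffOn_multiPartialD (hU : IsOpen U) (α : Fin d → ℕ) {k : ℕ}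
    {f : EuclideanSpace ℝ (Fin d) → ℝ} (hf : ContDiffOn ℝ ((k + ∑ i, α i : ℕ) : ℕ∞) f U) :
    ContDiffOn ℝ (k : ℕ∞) (multiPartialD α f) U :=
  contDiffOn_foldr_partialD hU α _ (by rwa [← List.sum_ofFn, List.ofFn_eq_map] at hf)

theorem partialD_multiPartialD (hU : IsOpen U) (α : Fin d → ℕ) (i : Fin d)
    {f : EuclideanSpace ℝ (Fin d) → ℝ} (hf : ContDiffOn ℝ ((∑ i, α i + 1 : ℕ) : ℕ∞) f U) :
    EqOn (partialD i (multiPartialD α f)) (multiPartialD (α + Pi.single i 1) f) U :=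
  partialD_foldr hU α i _ (List.nodup_finRange d) (List.mem_finRange i)
    (by rwa [← List.sum_ofFn, List.ofFn_eq_map] at hf)

/-- The derivative of a partial derivative of `f` along a line. -/
theorem hasDerivAt_multiPartialD_line (hU : IsOpen U) (α : Fin d → ℕ)
    {f : EuclideanSpace ℝ (Fin d) → ℝ} (hf : ContDiffOn ℝ ((∑ i, α i + 1 : ℕ) : ℕ∞) f U)
    {x v : EuclideanSpace ℝ (Fin d)} {r : ℝ} (hr : x + r • v ∈ U) :
    HasDerivAt (fun r : ℝ => multiPartialD α f (x + r • v))
      (∑ i, v i * multiPartialD (α + Pi.single i 1) f (x + r • v)) r := by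
  have hc : ContDiffOn ℝ ((0 + 1 : ℕ) : ℕ∞) (multiPartialD α f) U :=
    contDiffOn_multiPartialD hU α (by rwa [zero_add, add_comm])
  have hd : DifferentiableAt ℝ (multiPartialD α f) (x + r • v) :=
    (hc.contDiffAt (hU.mem_nhds hr)).differentiableAt (by simp)
  have hl : HasDerivAt (fun r : ℝ => x + r • v) v r := by
    simpa using ((hasDerivAt_id r).smul_const v).const_add x
  have h := hd.hasFDerivAt.comp_hasDerivAt r hl
  refine h.congr_deriv ?_
  have hv : ∑ i, v i • EuclideanSpace.single i (1 : ℝ) = v := by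
    ext j; simp [Pi.single_apply]
  rw [← congrArg (fderiv ℝ (multiPartialD α f) (x + r • v)) hv, map_sum]
  refine Finset.sum_congr rfl fun i _ => ?_
  rw [map_smul, smul_eq_mul, ← partialD_multiPartialD hU α i hf hr,
    partialD_eqOn_fderiv hU hc i hr]

/-- The value at `x` of the differential operator with symbol `P` applied to `f`. -/
noncomputable def symbolD (f : EuclideanSpace ℝ (Fin d) → ℝ) (x : EuclideanSpace ℝ (Fin d)) :
    MvPolynomial (Fin d) ℝ →ₗ[ℝ] ℝ :=
  (MvPolynomial.basisMonomials (Fin d) ℝ).constr ℝ fun α => multiPartialD (α : Fin d → ℕ) f x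

theorem symbolD_monomial (f : EuclideanSpace ℝ (Fin d) → ℝ) (x : EuclideanSpace ℝ (Fin d))
    (α : Fin d →₀ ℕ) (c : ℝ) :
    symbolD f x (MvPolynomial.monomial α c) = c * multiPartialD (α : Fin d → ℕ) f x := by
  have h1 := (MvPolynomial.basisMonomials (Fin d) ℝ).constr_basis ℝ
    (fun α : Fin d →₀ ℕ => multiPartialD (α : Fin d → ℕ) f x) α
  rw [MvPolynomial.coe_basisMonomials] at h1
  have h2 : MvPolynomial.monomial α c = c • MvPolynomial.monomial α (1 : ℝ) := by
    rw [MvPolynomial.smul_monomial, smul_eq_mul, mul_one]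
  rw [h2, map_smul, symbolD, h1, smul_eq_mul]

/-- Differentiating along `v` multiplies the symbol by `∑ v_i X_i`, so iterated derivatives become
powers of one linear form. The degree bound keeps one derivative of `f` in reserve. -/
theorem hasDerivAt_symbolD_line (hU : IsOpen U) {j : ℕ} {f : EuclideanSpace ℝ (Fin d) → ℝ}
    (hf : ContDiffOn ℝ ((j + 1 : ℕ) : ℕ∞) f U) {x v : EuclideanSpace ℝ (Fin d)} {r : ℝ}
    (hr : x + r • v ∈ U) {P : MvPolynomial (Fin d) ℝ} (hP : P.totalDegree ≤ j) :
    HasDerivAt (fun r : ℝ => symbolD f (x + r • v) P)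
      (symbolD f (x + r • v) ((∑ i, MvPolynomial.C (v i) * MvPolynomial.X i) * P)) r := by
  have h1 : ∀ y, symbolD f y P =
      ∑ α ∈ P.support, P.coeff α * multiPartialD (α : Fin d → ℕ) f y := by
    intro y
    conv_lhs => rw [P.as_sum, map_sum]
    exact Finset.sum_congr rfl fun α _ => symbolD_monomial f y α _
  have h2 : symbolD f (x + r • v) ((∑ i, MvPolynomial.C (v i) * MvPolynomial.X i) * P) =
      ∑ α ∈ P.support, P.coeff α *
        ∑ i, v i * multiPartialD ((α : Fin d → ℕ) + Pi.single i 1) f (x + r • v) := by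
    conv_lhs => rw [P.as_sum, Finset.mul_sum, map_sum]
    refine Finset.sum_congr rfl fun α _ => ?_
    rw [Finset.sum_mul, map_sum, Finset.mul_sum]
    refine Finset.sum_congr rfl fun i _ => ?_
    rw [mul_assoc, MvPolynomial.X, MvPolynomial.monomial_mul, MvPolynomial.C_mul_monomial,
      symbolD_monomial, Finsupp.coe_add, Finsupp.single_eq_pi_single, add_comm (Pi.single i 1)]
    ring
  simp only [h1, h2]
  refine HasDerivAt.fun_sum fun α hα => ?_
  refine (hasDerivAt_multiPartialD_line hU _ (hf.of_le ?_) hr).const_mul _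
  have h3 := (MvPolynomial.le_totalDegree hα).trans hP
  rw [Finsupp.sum_fintype _ _ (fun _ => rfl)] at h3
  exact_mod_cast Nat.succ_le_succ h3

/-- The `j`-th derivative at `r` of `f` along the line `r ↦ x + r • v`. -/
noncomputable def lineJet (f : EuclideanSpace ℝ (Fin d) → ℝ) (x v : EuclideanSpace ℝ (Fin d))
    (j : ℕ) (r : ℝ) : ℝ :=
  symbolD f (x + r • v) ((∑ i, MvPolynomial.C (v i) * MvPolynomial.X i) ^ j)

/-- The multinomial theorem produces exactly the coefficients `j! / α!` of `derivNormOn`. -/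
theorem lineJet_eq_sum (f : EuclideanSpace ℝ (Fin d) → ℝ) (x v : EuclideanSpace ℝ (Fin d))
    (j : ℕ) (r : ℝ) :
    lineJet f x v j r = ∑ α ∈ Finset.piAntidiag (Finset.univ : Finset (Fin d)) j,
      (Nat.multinomial Finset.univ α : ℝ) * ((∏ i, v i ^ α i) * multiPartialD α f (x + r • v)) := by
  rw [lineJet, Finset.sum_pow_eq_sum_piAntidiag, map_sum]
  refine Finset.sum_congr rfl fun α _ => ?_
  have h : ∏ i, (MvPolynomial.C (v i) * MvPolynomial.X i : MvPolynomial (Fin d) ℝ) ^ α i =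
      MvPolynomial.monomial (Finsupp.equivFunOnFinite.symm α) (∏ i, v i ^ α i) := by
    rw [MvPolynomial.monomial_eq, Finsupp.prod_fintype _ _ (fun _ => pow_zero _)]
    simp [mul_pow, Finset.prod_mul_distrib]
  rw [h, ← nsmul_eq_mul, map_nsmul, nsmul_eq_mul, symbolD_monomial]
  simp

theorem lineJet_zero (f : EuclideanSpace ℝ (Fin d) → ℝ) (x v : EuclideanSpace ℝ (Fin d)) (r : ℝ) :
    lineJet f x v 0 r = f (x + r • v) := by
  have h : multiPartialD (0 : Fin d → ℕ) f = f := by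
    simp only [multiPartialD, Pi.zero_apply, Function.iterate_zero, id]
    exact List.foldr_fixed _
  simp [lineJet_eq_sum, h, Nat.multinomial]

theorem hasDerivAt_lineJet (hU : IsOpen U) {j : ℕ} {f : EuclideanSpace ℝ (Fin d) → ℝ}
    (hf : ContDiffOn ℝ ((j + 1 : ℕ) : ℕ∞) f U) {x v : EuclideanSpace ℝ (Fin d)} {r : ℝ}
    (hr : x + r • v ∈ U) : HasDerivAt (lineJet f x v j) (lineJet f x v (j + 1) r) r := by
  have h := hasDerivAt_symbolD_line hU hf hr
    (P := (∑ i, MvPolynomial.C (v i) * MvPolynomial.X i) ^ j) ?_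
  · rw [← pow_succ'] at h
    exact h
  · refine (MvPolynomial.totalDegree_pow _ _).trans ?_
    refine (Nat.mul_le_mul_left j ?_).trans (mul_one j).le
    refine MvPolynomial.totalDegree_finsetSum_le fun i _ => ?_
    rw [← MvPolynomial.smul_eq_C_mul]
    exact (MvPolynomial.totalDegree_smul_le _ _).trans (MvPolynomial.totalDegree_X i).le

theorem abs_le_supNormOn {K : Set (EuclideanSpace ℝ (Fin d))} (hK : IsCompact K)
    {g : EuclideanSpace ℝ (Fin d) → ℝ} (hg : ContinuousOn g K) {x : EuclideanSpace ℝ (Fin d)}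
    (hx : x ∈ K) : |g x| ≤ supNormOn K g := by
  have hb : BddAbove (range fun x : K => |g x|) := by
    have := hK.bddAbove_image hg.abs
    rwa [image_eq_range] at this
  exact le_ciSup hb ⟨x, hx⟩

theorem abs_lineJet_le (hU : IsOpen U) {K : Set (EuclideanSpace ℝ (Fin d))} (hK : IsCompact K)
    (hKU : K ⊆ U) {j : ℕ} {f : EuclideanSpace ℝ (Fin d) → ℝ} (hf : ContDiffOn ℝ (j : ℕ∞) f U)
    {x v : EuclideanSpace ℝ (Fin d)} {r δ : ℝ} (hv : ‖v‖ ≤ δ) (hr : x + r • v ∈ K) :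
    |lineJet f x v j r| ≤ δ ^ j * derivNormOn j K f := by
  rw [lineJet_eq_sum, derivNormOn, Finset.mul_sum]
  refine (Finset.abs_sum_le_sum_abs _ _).trans (Finset.sum_le_sum fun α hα => ?_)
  have hα' : ∑ i, α i = j := (Finset.mem_piAntidiag.1 hα).1
  rw [abs_mul, abs_mul, Nat.abs_cast, Finset.abs_prod, mul_left_comm (δ ^ j)]
  have h1 : ∏ i, |v i ^ α i| ≤ δ ^ j := by
    rw [← hα', ← Finset.prod_pow_eq_pow_sum]
    refine Finset.prod_le_prod (fun i _ => abs_nonneg _) fun i _ => ?_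
    rw [abs_pow]
    have := (PiLp.norm_apply_le v i).trans hv
    exact pow_le_pow_left₀ (abs_nonneg _) this _
  have h2 : |multiPartialD α f (x + r • v)| ≤ supNormOn K (multiPartialD α f) := by
    refine abs_le_supNormOn hK ?_ hr
    exact (contDiffOn_multiPartialD hU α (k := 0)
      (by rwa [zero_add, hα'])).continuousOn.mono hKU
  have h3 : 0 ≤ δ := (norm_nonneg _).trans hv
  gcongr

end PartialDerivatives

/-! ### Growth of the interpolant and the degree of the weight -/

theorem sidedDeriv_eq_derivWithin_Icc {m : ℝ → ℝ} {a b s : ℝ} (ha : 1 ≤ a)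
    (hm : ContDiffOn ℝ 1 m (Icc a b)) (hs : s ∈ Ioc a b) :
    sidedDeriv m s = derivWithin m (Icc a b) s ∧
      HasDerivWithinAt m (sidedDeriv m s) (Iic s) s := by
  have h1 : HasDerivWithinAt m (derivWithin m (Icc a b) s) (Icc a b) s :=
    (hm.differentiableOn (by simp) s (Ioc_subset_Icc_self hs)).hasDerivWithinAt
  have h2 : HasDerivWithinAt m (derivWithin m (Icc a b) s) (Iic s) s :=
    (h1.mono (Icc_subset_Icc_right hs.2)).mono_of_mem_nhdsWithin
      (Icc_mem_nhdsLE hs.1)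
  have h3 : sidedDeriv m s = derivWithin m (Icc a b) s := by
    rw [sidedDeriv, if_neg (ha.trans_lt hs.1).ne']
    exact h2.derivWithin (uniqueDiffWithinAt_Iic s)
  exact ⟨h3, h3 ▸ h2⟩

theorem IsWeightInterpolant.hasDerivWithinAt {m : ℝ → ℝ} {μ : ℕ → ℝ}
    (hm : IsWeightInterpolant m μ) {s : ℝ} (hs : 1 < s) :
    HasDerivWithinAt m (sidedDeriv m s) (Iic s) s := by
  obtain ⟨a, ha0, ha, hat, hC⟩ := hm.piecewise
  have hex : ∃ k, s ≤ a k := (hat.eventually_ge_atTop s).exists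
  obtain ⟨k, hk⟩ : ∃ k, Nat.find hex = k + 1 := by
    refine Nat.exists_eq_succ_of_ne_zero fun h => ?_
    have := Nat.find_spec hex
    rw [h, ha0] at this
    linarith
  have h1 : a k < s := not_le.1 (Nat.find_min hex (by omega : k < Nat.find hex))
  have h2 : s ≤ a (k + 1) := hk ▸ Nat.find_spec hex
  exact (sidedDeriv_eq_derivWithin_Icc (ha0 ▸ ha.monotone (Nat.zero_le k)) (hC k) ⟨h1, h2⟩).2

/-- Needed because `sSup` of an unbounded set of reals is `0`. On each piece the quotient agrees,
off the left end, with a continuous function on a compact interval, and finitely many pieces cover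
`[1, b]`. -/
theorem IsWeightInterpolant.bddAbove {m : ℝ → ℝ} {μ : ℕ → ℝ}
    (hm : IsWeightInterpolant m μ) (b : ℝ) :
    BddAbove ((fun s : ℝ => s * sidedDeriv m s / m s) '' Icc 1 b) := by
  obtain ⟨a, ha0, ha, hat, hC⟩ := hm.piecewise
  have hk : ∀ k, BddAbove ((fun s : ℝ => s * sidedDeriv m s / m s) '' Icc 1 (a k)) := by
    intro k
    induction k with
    | zero => rw [ha0, Icc_self, image_singleton]; exact bddAbove_singleton
    | succ k ih =>
      have ha1 : 1 ≤ a k := ha0 ▸ ha.monotone (Nat.zero_le k)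
      have hlt : a k < a (k + 1) := ha (Nat.lt_succ_self k)
      have hcont : ContinuousOn (fun s : ℝ => s * derivWithin m (Icc (a k) (a (k + 1))) s / m s)
          (Icc (a k) (a (k + 1))) := by
        refine (continuousOn_id.mul
          ((hC k).continuousOn_derivWithin (uniqueDiffOn_Icc hlt) le_rfl)).div
          (hC k).continuousOn fun s hs => (hm.pos s (ha1.trans hs.1)).ne'
      refine (ih.union (isCompact_Icc.bddAbove_image hcont)).mono ?_
      rintro _ ⟨s, hs, rfl⟩
      rcases le_or_gt s (a k) with h | h
      · exact Or.inl ⟨s, ⟨hs.1, h⟩, rfl⟩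
      · refine Or.inr ⟨s, ⟨h.le, hs.2⟩, ?_⟩
        simp only [(sidedDeriv_eq_derivWithin_Icc ha1 (hC k) ⟨h, hs.2⟩).1]
  obtain ⟨k, hkb⟩ := (hat.eventually_ge_atTop b).exists
  exact (hk k).mono (image_mono (Icc_subset_Icc_right hkb))

theorem IsWeightInterpolant.gammaSup_nonneg {m : ℝ → ℝ} {μ : ℕ → ℝ}
    (hm : IsWeightInterpolant m μ) {n : ℕ} (hn : 1 ≤ n) : 0 ≤ gammaSup m n := by
  have h1 : (1 : ℝ) * sidedDeriv m 1 / m 1 ≤ gammaSup m n :=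
    le_csSup (hm.bddAbove n) ⟨1, ⟨le_rfl, by exact_mod_cast hn⟩, rfl⟩
  refine le_trans ?_ h1
  rw [sidedDeriv, if_pos rfl, one_mul]
  exact div_nonneg hm.mono.derivWithin_nonneg (hm.pos 1 le_rfl).le

/-- An interpolant grows at most polynomially, with exponent `gammaSup m n`, on `[1, n]`. -/
theorem IsWeightInterpolant.le_mul_rpow {m : ℝ → ℝ} {μ : ℕ → ℝ}
    (hm : IsWeightInterpolant m μ) {n : ℕ} {s t : ℝ} (hs : 1 ≤ s) (hst : s ≤ t) (htn : t ≤ n) :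
    m t ≤ m s * (t / s) ^ gammaSup m n := by
  have hms := hm.pos s hs
  have hmt := hm.pos t (hs.trans hst)
  set γ := gammaSup m n with hγ
  -- Compares `log m` with `γ log`. The substitution `u = -s` turns the left derivatives into the
  -- right derivatives of the comparison principle.
  have key : -Real.log (m s) ≤ -γ * Real.log s + (γ * Real.log t - Real.log (m t)) := by
    have h := image_le_of_deriv_right_le_deriv_boundary (a := -t) (b := -s)
      (f := fun u => -Real.log (m (-u))) (f' := fun u => sidedDeriv m (-u) / m (-u))
      (B := fun u => -γ * Real.log (-u) + (γ * Real.log t - Real.log (m t)))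
      (B' := fun u => γ / (-u)) ?_ ?_ ?_ ?_ ?_ ?_ (right_mem_Icc.2 (by linarith : -t ≤ -s))
    · simpa using h
    · refine ContinuousOn.neg (ContinuousOn.log ?_ ?_)
      · refine hm.cont.comp continuousOn_neg fun u hu => ?_
        rw [mem_Ici]; linarith [hu.2]
      · intro u hu
        exact (hm.pos _ (by linarith [hu.2])).ne'
    · intro u hu
      have h1 := hm.hasDerivWithinAt (s := -u) (by linarith [hu.2])
      have h2 : HasDerivWithinAt (fun u : ℝ => m (-u)) (-sidedDeriv m (-u)) (Ici u) u := by
        have := h1.comp u (hasDerivWithinAt_neg u (Ici u)) (fun x hx => by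
          simpa using hx)
        simpa [Function.comp_def] using this
      have h3 := (h2.log (hm.pos _ (by linarith [hu.2])).ne').neg
      exact h3.congr_deriv (by rw [neg_div, neg_neg])
    · simp
    · refine ContinuousOn.add (continuousOn_const.mul (ContinuousOn.log continuousOn_neg ?_))
        continuousOn_const
      intro u hu
      have := hu.2
      exact (by linarith : 0 < -u).ne'
    · intro u hu
      have hu0 : -u ≠ 0 := by have := hu.2; exact (by linarith : 0 < -u).ne'
      have h1 := (((hasDerivAt_neg u).log hu0).const_mul (-γ)).add_const
        (γ * Real.log t - Real.log (m t))
      refine (h1.congr_deriv ?_).hasDerivWithinAt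
      field_simp
    · intro u hu
      have hu1 : 1 ≤ -u := by linarith [hu.2]
      have h1 : -u * sidedDeriv m (-u) / m (-u) ≤ γ :=
        le_csSup (hm.bddAbove n) ⟨-u, ⟨hu1, by linarith [hu.1]⟩, rfl⟩
      have h2 := hm.pos _ hu1
      rw [div_le_iff₀ h2] at h1
      rw [div_le_div_iff₀ h2 (by linarith)]
      linarith
  have hs0 : 0 < s := by linarith
  have ht0 : 0 < t := by linarith
  rw [← Real.log_le_log_iff hmt (by positivity), Real.log_mul hms.ne' (by positivity),
    Real.log_rpow (by positivity), Real.log_div ht0.ne' hs0.ne']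
  linarith

theorem weightDegree_spec {ν : ℕ → ℝ} {N : ℕ} (hpos : ∀ j, 1 ≤ j → 0 ≤ ν j) (hN : 2 ≤ N)
    (h : (N : ℕ∞) = weightDegree ν 1 + 1) :
    weightSum ν 1 (N - 1) < Real.exp 1 ∧ Real.exp 1 ≤ weightSum ν 1 N := by
  have h0 : startIndex 1 = 0 := by simp [startIndex]
  have hd : weightDegree ν 1 = ((N - 1 : ℕ) : ℕ∞) := by
    generalize weightDegree ν 1 = D at h
    induction D using ENat.recTopCoe with
    | top => simp at h
    | coe D =>
      have : N = D + 1 := by exact_mod_cast h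
      rw [this, Nat.add_sub_cancel]
  rw [weightDegree, h0, zero_add] at hd
  have hmono : Monotone (weightSum ν 1) := fun a b hab =>
    Finset.sum_le_sum_of_subset_of_nonneg (Finset.Icc_subset_Icc_right hab)
      fun i hi _ => one_div_nonneg.2 (hpos i (Finset.mem_Icc.1 hi).1)
  constructor
  · by_contra hcon
    have : (⨆ n ∈ {n : ℕ | weightSum ν 1 n < Real.exp 1}, (n : ℕ∞)) ≤ ((N - 2 : ℕ) : ℕ∞) := by
      refine iSup₂_le fun n hn => ?_
      rw [Nat.cast_le]
      by_contra! hlt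
      exact hcon ((hmono (by omega)).trans_lt hn)
    rw [hd, Nat.cast_le] at this
    omega
  · by_contra! hcon
    have : (N : ℕ∞) ≤ ⨆ n ∈ {n : ℕ | weightSum ν 1 n < Real.exp 1}, (n : ℕ∞) :=
      le_iSup₂_of_le N hcon le_rfl
    rw [hd, Nat.cast_le] at this
    omega

/-- Lower bound for the products of the weights below the degree. -/
theorem IsWeightInterpolant.pow_le_exp_mul_prod {m : ℝ → ℝ} {μ : ℕ → ℝ}
    (hm : IsWeightInterpolant m μ) (hμ : IsAdmissibleWeight μ) {δ : ℝ} (hδ : 0 < δ) {n p : ℕ}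
    (hn : 1 ≤ n) (hnp : n ≤ p) (hsum : weightSum (fun j => δ * μ j) 1 n < Real.exp 1) {j : ℕ}
    (hj : j ≤ n) :
    (n : ℝ) ^ j ≤ Real.exp (j + n * gammaSup m p) * ∏ i ∈ Finset.Icc 1 j, (δ * μ i) := by
  set γ := gammaSup m p
  have hγ : 0 ≤ γ := hm.gammaSup_nonneg (hn.trans hnp)
  have hn0 : (0 : ℝ) < n := by exact_mod_cast hn
  have hmon : ∀ i, 1 ≤ i → i ≤ n → μ i ≤ μ n := by
    intro i hi hin
    rw [← hm.interp i hi, ← hm.interp n hn]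
    refine hm.mono ?_ ?_ ?_ <;> simp [hi, hn, hin]
  -- All `n` terms of the sum are at least `1 / (δ μ_n)`, and the sum is below `e`.
  have hnn : (n : ℝ) ≤ Real.exp 1 * (δ * μ n) := by
    have hμn : 0 < δ * μ n := mul_pos hδ (hμ.pos n hn)
    have : (n : ℝ) / (δ * μ n) ≤ weightSum (fun j => δ * μ j) 1 n := by
      rw [weightSum]
      calc (n : ℝ) / (δ * μ n) = ∑ i ∈ Finset.Icc 1 n, 1 / (δ * μ n) := by
            simp [div_eq_mul_inv]
        _ ≤ _ := Finset.sum_le_sum fun i hi => by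
            obtain ⟨h1, h2⟩ := Finset.mem_Icc.1 hi
            exact one_div_le_one_div_of_le (mul_pos hδ (hμ.pos i h1))
              (mul_le_mul_of_nonneg_left (hmon i h1 h2) hδ.le)
    have := this.trans hsum.le
    rwa [div_le_iff₀ hμn] at this
  have hterm : ∀ i ∈ Finset.Icc 1 j, (n : ℝ) ≤
      Real.exp 1 * (δ * μ i) * ((n : ℝ) / i) ^ γ := by
    intro i hi
    obtain ⟨h1, h2⟩ := Finset.mem_Icc.1 hi
    have h3 := hm.le_mul_rpow (n := p) (s := i) (t := n) (by exact_mod_cast h1)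
      (by exact_mod_cast h2.trans hj) (by exact_mod_cast hnp)
    rw [hm.interp i h1, hm.interp n hn] at h3
    refine hnn.trans ?_
    rw [mul_assoc, mul_assoc]
    gcongr
  have h1 : (n : ℝ) ^ j ≤ ∏ i ∈ Finset.Icc 1 j, (Real.exp 1 * (δ * μ i) * ((n : ℝ) / i) ^ γ) := by
    have := Finset.prod_le_prod (fun i _ => hn0.le) hterm
    simpa using this
  refine h1.trans ?_
  rw [Finset.prod_mul_distrib, Finset.prod_mul_distrib,
    Real.finsetProd_rpow _ _ (fun i _ => by positivity)]
  -- The product is `n ^ j / j!`, a single term of the series of `e ^ n`.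
  have h2 : ∏ i ∈ Finset.Icc 1 j, ((n : ℝ) / i) ≤ Real.exp n := by
    have := Real.pow_div_factorial_le_exp (x := n) hn0.le j
    rw [Finset.prod_div_distrib]
    have h3 : (∏ i ∈ Finset.Icc 1 j, (i : ℝ)) = j.factorial := by
      rw [← Finset.prod_range_add_one_eq_factorial, Finset.range_eq_Ico,
        Finset.prod_Ico_add' (fun x => x) 0 j 1]
      push_cast
      rfl
    rw [h3]
    simpa using this
  have h3 : (∏ i ∈ Finset.Icc 1 j, ((n : ℝ) / i)) ^ γ ≤ Real.exp (n * γ) := by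
    rw [Real.exp_mul]
    exact Real.rpow_le_rpow (Finset.prod_nonneg fun i _ => by positivity) h2 hγ
  have h4 : 0 ≤ ∏ i ∈ Finset.Icc 1 j, (δ * μ i) := Finset.prod_nonneg fun i hi =>
    (mul_pos hδ (hμ.pos i (Finset.mem_Icc.1 hi).1)).le
  rw [Finset.prod_const, Nat.card_Icc, Nat.add_sub_cancel, ← Real.exp_nat_mul, mul_one, Real.exp_add]
  calc _ ≤ Real.exp j * (∏ i ∈ Finset.Icc 1 j, (δ * μ i)) * Real.exp (n * γ) := by gcongr
    _ = _ := by ring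

/-! ### From segments to volumes -/

section Rays

open scoped Pointwise

variable {V : Type*} [NormedAddCommGroup V] [NormedSpace ℝ V]

/-- A bound for the proportion of `E` on segments from `x₀` inside `K ⊇ E` extends to all segments
from `x₀`. -/
theorem volume_ray_le {K E : Set V} (hK : IsClosed K) {x₀ : V} (hx₀ : x₀ ∈ K) (hE : E ⊆ K)
    {c : ENNReal}
    (h : ∀ v, x₀ + v ∈ K → volume {r : ℝ | r ∈ Icc (0 : ℝ) 1 ∧ x₀ + r • v ∈ E} ≤ c) (v : V) :
    volume {r : ℝ | r ∈ Icc (0 : ℝ) 1 ∧ x₀ + r • v ∈ E} ≤ c := by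
  -- A segment that leaves `K` is cut at the last parameter `ρ ≤ 1` inside `K`; rescaling by `ρ` can
  -- only decrease length.
  set R : Set ℝ := Icc 0 1 ∩ (fun r : ℝ => x₀ + r • v) ⁻¹' K with hR
  have hRc : IsCompact R := isCompact_Icc.inter_right (hK.preimage (by fun_prop))
  have hRne : R.Nonempty := ⟨0, by simp [hR, hx₀]⟩
  obtain ⟨ρ, hρR, hρ⟩ := hRc.exists_isGreatest hRne
  rcases hρR.1.1.eq_or_lt with h0 | h0
  · have : {r : ℝ | r ∈ Icc (0 : ℝ) 1 ∧ x₀ + r • v ∈ E} ⊆ {0} := by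
      rintro r ⟨hr, hrE⟩
      have := hρ ⟨hr, hE hrE⟩
      exact le_antisymm (by linarith) hr.1
    exact (measure_mono this).trans (by simp)
  · have hsub : {r : ℝ | r ∈ Icc (0 : ℝ) 1 ∧ x₀ + r • v ∈ E} ⊆
        ρ • {r : ℝ | r ∈ Icc (0 : ℝ) 1 ∧ x₀ + r • (ρ • v) ∈ E} := by
      rintro r ⟨hr, hrE⟩
      have hrρ := hρ ⟨hr, hE hrE⟩
      refine ⟨r / ρ, ⟨⟨by have := hr.1; positivity, by rwa [div_le_one h0]⟩, ?_⟩, ?_⟩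
      · rwa [smul_smul, div_mul_cancel₀ _ h0.ne']
      · simp only [smul_eq_mul]; field_simp
    refine (measure_mono hsub).trans ?_
    rw [Measure.addHaar_smul]
    refine (mul_le_of_le_one_left' ?_).trans (h (ρ • v) hρR.2)
    rw [Module.finrank_self, pow_one, abs_of_pos h0]
    exact ENNReal.ofReal_le_one.2 hρR.1.2

variable [MeasurableSpace V] [BorelSpace V] [FiniteDimensional ℝ V]

/-- If `E ⊆ K` occupies at most the proportion `c` of every segment from `x₀`, then its measure is
controlled by that of `K`. -/
theorem measure_mul_le_of_ray_le (η : Measure V) [η.IsAddHaarMeasure] {K E : Set V}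
    (hKconv : Convex ℝ K) {x₀ : V}
    (hx₀ : x₀ ∈ K) (hE : E ⊆ K) (hEm : MeasurableSet E) {c : ENNReal}
    (h : ∀ v, volume {r : ℝ | r ∈ Icc (0 : ℝ) 1 ∧ x₀ + r • v ∈ E} ≤ c) {s : ℝ} (hs : 0 < s) :
    ENNReal.ofReal (1 - s) * η E ≤ c * (ENNReal.ofReal ((s⁻¹) ^ Module.finrank ℝ V) * η K) := by
  set F : Set V := (fun v => x₀ + v) ⁻¹' E with hF
  have hFm : MeasurableSet F := hEm.preimage (measurable_const_add x₀)
  have hηF : η F = η E := measure_preimage_add η x₀ E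
  set L : Set V := (fun v => x₀ + v) ⁻¹' K with hL
  have hηL : η L = η K := measure_preimage_add η x₀ K
  -- Fubini on `W` replaces polar coordinates. The slice at `r ≤ 1` is `r⁻¹ F`, no smaller than `F`;
  -- the slice at `v` has measure at most `c` and is empty unless `v ∈ s⁻¹ L`.
  set W : Set (ℝ × V) := {q | q.1 ∈ Icc s 1 ∧ q.1 • q.2 ∈ F} with hW
  have hWm : MeasurableSet W :=
    (measurable_fst measurableSet_Icc).inter ((measurable_fst.smul measurable_snd) hFm)
  have h1 : ENNReal.ofReal (1 - s) * η E ≤ (volume.prod η) W := by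
    rw [Measure.prod_apply hWm]
    calc ENNReal.ofReal (1 - s) * η E = ∫⁻ r in Icc s 1, η F := by
          rw [setLIntegral_const, Real.volume_Icc, hηF, mul_comm]
      _ ≤ ∫⁻ r in Icc s 1, η (Prod.mk r ⁻¹' W) := by
          refine setLIntegral_mono' measurableSet_Icc fun r hr => ?_
          have hr0 : 0 < r := hs.trans_le hr.1
          have : Prod.mk r ⁻¹' W = (r • ·) ⁻¹' F := by
            ext v
            exact and_iff_right hr
          rw [this, Measure.addHaar_preimage_smul η hr0.ne']
          refine le_mul_of_one_le_left' ?_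
          rw [ENNReal.one_le_ofReal, abs_of_pos (by positivity)]
          exact (one_le_inv₀ (by positivity)).2 (pow_le_one₀ hr0.le hr.2)
      _ ≤ _ := setLIntegral_le_lintegral _ _
  refine h1.trans ?_
  rw [Measure.prod_apply_symm hWm]
  have h2 : ∀ v, volume ((fun r : ℝ => (r, v)) ⁻¹' W) ≤ (s⁻¹ • L).indicator (fun _ => c) v := by
    intro v
    by_cases hv : v ∈ s⁻¹ • L
    · rw [indicator_of_mem hv]
      refine (measure_mono ?_).trans (h v)
      rintro r ⟨hr, hrF⟩
      exact ⟨⟨hs.le.trans hr.1, hr.2⟩, hrF⟩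
    · rw [indicator_of_notMem hv, nonpos_iff_eq_zero]
      convert measure_empty (μ := (volume : Measure ℝ))
      rw [eq_empty_iff_forall_notMem]
      rintro r ⟨hr, hrF⟩
      have hr0 : 0 < r := hs.trans_le hr.1
      refine hv ((mem_inv_smul_set_iff₀ hs.ne' _ _).2 ?_)
      have h3 : x₀ + r • v ∈ K := hE hrF
      have h4 := hKconv.add_smul_mem hx₀ h3 (t := s / r)
        ⟨by positivity, (div_le_one hr0).2 hr.1⟩
      rwa [smul_smul, div_mul_cancel₀ _ hr0.ne'] at h4
  refine (lintegral_mono h2).trans ((lintegral_indicator_const_le _ _).trans ?_)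
  rw [Measure.addHaar_smul, abs_of_pos (by positivity), hηL]

end Rays

/-! ### Exponential tails, sublevel sets and mean oscillation -/

/-- The expectation of a non-negative function with an exponential tail. -/
theorem lintegral_le_of_exp_tail {X : Type*} [MeasurableSpace X] {η : Measure X}
    {h : X → ℝ} (h0 : 0 ≤ᵐ[η] h) (hm : AEMeasurable h η) {k b Λ : ℝ} (hk : 0 < k)
    (hb : 0 ≤ b) (hΛ : 0 ≤ Λ) (hη : η univ ≤ ENNReal.ofReal b)
    (htail : ∀ u, 0 ≤ u → η {x | k * u ≤ h x} ≤ ENNReal.ofReal (b * Real.exp (Λ - u))) :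
    ∫⁻ x, ENNReal.ofReal (h x) ∂η ≤ ENNReal.ofReal (k * b * (Λ + 1)) := by
  rw [lintegral_eq_lintegral_meas_le η h0 hm]
  have hkΛ : 0 ≤ k * Λ := by positivity
  -- At `kΛ` the tail bound equals the total mass bound `b`: the latter is used below, the former
  -- above.
  rw [← Ioc_union_Ioi_eq_Ioi hkΛ]
  refine (lintegral_union_le _ _ _).trans ?_
  have h1 : ∫⁻ t in Ioc 0 (k * Λ), η {x | t ≤ h x} ≤ ENNReal.ofReal (b * (k * Λ)) := by
    calc _ ≤ ∫⁻ t in Ioc 0 (k * Λ), ENNReal.ofReal b :=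
          lintegral_mono fun t => (measure_mono (subset_univ _)).trans hη
      _ = _ := by
          rw [setLIntegral_const, Real.volume_Ioc, sub_zero, ← ENNReal.ofReal_mul hb]
  have h2 : ∫⁻ t in Ioi (k * Λ), η {x | t ≤ h x} ≤ ENNReal.ofReal (b * k) := by
    have hneg : -k⁻¹ < 0 := by simpa using hk
    have hint := (integrableOn_exp_mul_Ioi hneg (k * Λ)).const_mul (b * Real.exp Λ)
    calc _ ≤ ∫⁻ t in Ioi (k * Λ), ENNReal.ofReal (b * Real.exp Λ * Real.exp (-k⁻¹ * t)) := by
          refine setLIntegral_mono' measurableSet_Ioi fun t ht => ?_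
          have ht0 : 0 ≤ t := hkΛ.trans (le_of_lt ht)
          have := htail (t / k) (by positivity)
          rw [mul_div_cancel₀ _ hk.ne'] at this
          refine this.trans (le_of_eq ?_)
          rw [mul_assoc, ← Real.exp_add]
          congr 3
          field_simp
          ring
      _ = ENNReal.ofReal (∫ t in Ioi (k * Λ), b * Real.exp Λ * Real.exp (-k⁻¹ * t)) := by
          rw [ofReal_integral_eq_lintegral_ofReal hint]
          exact Eventually.of_forall fun t => by positivity
      _ = _ := by
          rw [integral_const_mul, integral_exp_mul_Ioi hneg]
          congr 1
          have : -k⁻¹ * (k * Λ) = -Λ := by field_simp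
          rw [this, Real.exp_neg]
          field_simp
  refine (add_le_add h1 h2).trans (le_of_eq ?_)
  rw [← ENNReal.ofReal_add (by positivity) (by positivity)]
  congr 1; ring

/-- The sublevel sets of a weight-smooth function are small. -/
theorem volume_sublevel_le {d : ℕ} (hd : 1 ≤ d) {K : Set (EuclideanSpace ℝ (Fin d))}
    {μ : ℕ → ℝ} {N : ℕ} (hdata : IsAdmissibleData μ K N) (hN : 2 ≤ N)
    {m : ℝ → ℝ} (hm : IsWeightInterpolant m μ) {f : EuclideanSpace ℝ (Fin d) → ℝ}
    (hf : IsWeightSmooth μ (2 * (N - 1)) (supNormOn K f) K f) {u : ℝ} :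
    volume {x | x ∈ K ∧ |f x| ≤ supNormOn K f * Real.exp (-(2 * (N - 1 : ℕ) * u))} ≤
      ENNReal.ofReal (remezConst m N * d * volume.real K * Real.exp (-u)) := by
  obtain ⟨hM, ⟨U, hU, hKU, hfU⟩, hder⟩ := hf
  obtain ⟨n, rfl⟩ : ∃ n, N = n + 1 := ⟨N - 1, by omega⟩
  rw [Nat.add_sub_cancel] at hfU hder ⊢
  set M := supNormOn K f
  set δ := Metric.diam K
  set γ := gammaSup m (2 * n) with hγ
  have hn : 1 ≤ n := by omega
  have hγ0 : 0 ≤ γ := hm.gammaSup_nonneg (by omega)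
  have hKc := hdata.body.compact
  have hfc : ContinuousOn f K := hfU.continuousOn.mono hKU
  obtain ⟨x₀, hx₀, hx₀M⟩ : ∃ x₀ ∈ K, |f x₀| = M := by
    obtain ⟨x₀, hx₀, hmax⟩ := hKc.exists_isMaxOn
      (hdata.body.nonempty_interior.mono interior_subset) hfc.abs
    have : Nonempty K := ⟨⟨x₀, hx₀⟩⟩
    exact ⟨x₀, hx₀, le_antisymm (abs_le_supNormOn hKc hfc hx₀)
      (ciSup_le fun x => hmax x.2)⟩
  have hspec := weightDegree_spec (ν := fun j => δ * μ j)
    (fun j hj => mul_nonneg Metric.diam_nonneg (hdata.weight.pos j hj).le) hN hdata.eq_degree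
  -- If `δ = 0`, the convention `1 / 0 = 0` would make the weight sum vanish, though it is at least
  -- `e`.
  have hδ : 0 < δ := by
    refine lt_of_le_of_ne Metric.diam_nonneg fun h => ?_
    have := hspec.2
    simp only [weightSum, ← h, zero_mul, div_zero, Finset.sum_const_zero] at this
    exact absurd this (not_le.2 (Real.exp_pos 1))
  set lam := 2 * Real.exp (2 + γ) * Real.exp (-u) with hlam
  set E := {x | x ∈ K ∧ |f x| ≤ M * Real.exp (-(2 * n * u))} with hE
  have hEK : E ⊆ K := fun x hx => hx.1
  have hEm : MeasurableSet E := by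
    have : IsClosed E := hfc.abs.preimage_isClosed_of_isClosed hKc.isClosed isClosed_Iic
    exact this.measurableSet
  have hray : ∀ v, volume {r : ℝ | r ∈ Icc (0 : ℝ) 1 ∧ x₀ + r • v ∈ E} ≤ ENNReal.ofReal lam := by
    refine volume_ray_le hKc.isClosed hx₀ hEK fun v hv => ?_
    have hseg : ∀ r ∈ Icc (0 : ℝ) 1, x₀ + r • v ∈ K := fun r hr =>
      hdata.body.convex.add_smul_mem hx₀ hv hr
    have hvδ : ‖v‖ ≤ δ := by
      have := Metric.dist_le_diam_of_mem hKc.isBounded hv hx₀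
      rwa [dist_eq_norm, add_sub_cancel_left] at this
    refine volume_le_of_abs_le hn hM hγ0
      (fun j hj => mul_pos hδ (hdata.weight.pos j hj))
      (fun j hj => mul_le_mul_of_nonneg_left (hdata.weight.mono j hj) hδ.le) hspec.2
      (fun j hj => hm.pow_le_exp_mul_prod hdata.weight hδ hn (by omega) hspec.1 hj)
      (φ := lineJet f x₀ v) ?_ ?_ ?_ (fun r hr => hr.1) ?_
    -- Bang's estimate uses `n + 1` derivatives, and `n + 1 ≤ 2n`.
    · intro i hi r hr
      refine hasDerivAt_lineJet hU (hfU.of_le ?_) (hKU (hseg r hr))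
      exact_mod_cast (by omega : i + 1 ≤ 2 * n)
    · intro i hi r hr
      have hi2 : i ≤ 2 * n := by omega
      refine (abs_lineJet_le hU hKc hKU (hfU.of_le (by exact_mod_cast hi2)) hvδ
        (hseg r hr)).trans ?_
      refine (mul_le_mul_of_nonneg_left (hder i hi2) (by positivity)).trans (le_of_eq ?_)
      rw [Finset.prod_mul_distrib, Finset.prod_const, Nat.card_Icc, Nat.add_sub_cancel]
      ring
    · rw [lineJet_zero, zero_smul, add_zero, hx₀M]
    · intro r hr
      rw [lineJet_zero]
      exact hr.2.2
  have hd0 : (0 : ℝ) < d := by exact_mod_cast hd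
  have hd1 : (1 : ℝ) ≤ d := by exact_mod_cast hd
  have hs1 : (d : ℝ) / (d + 1) < 1 := (div_lt_one (by positivity)).2 (by linarith)
  -- With this `s`, `1 - s = 1 / (d + 1)` and `s⁻¹ ^ d = (1 + 1/d) ^ d ≤ e`.
  have hmain := measure_mul_le_of_ray_le volume hdata.body.convex hx₀ hEK hEm hray
    (s := d / (d + 1)) (by positivity)
  rw [finrank_euclideanSpace_fin] at hmain
  have hKfin : volume K ≠ ⊤ := hKc.measure_lt_top.ne
  have hEfin : volume E ≠ ⊤ := ((measure_mono hEK).trans_lt hKc.measure_lt_top).ne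
  have hreal : (1 - (d : ℝ) / (d + 1)) * volume.real E ≤
      lam * (((d : ℝ) / (d + 1))⁻¹ ^ d * volume.real K) := by
    have h1 := ENNReal.toReal_mono (by finiteness) hmain
    have h2 : (0 : ℝ) ≤ lam := by positivity
    simpa only [measureReal_def, ENNReal.toReal_mul, ENNReal.toReal_ofReal (sub_nonneg.2 hs1.le),
      ENNReal.toReal_ofReal h2,
      ENNReal.toReal_ofReal (by positivity : 0 ≤ ((d : ℝ) / (d + 1))⁻¹ ^ d)] using h1
  rw [← ofReal_measureReal hEfin]
  apply ENNReal.ofReal_le_ofReal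
  have hpow : ((d : ℝ) / (d + 1))⁻¹ ^ d ≤ Real.exp 1 := by
    have h1 : ((d : ℝ) / (d + 1))⁻¹ ≤ Real.exp (1 / d) := by
      have := Real.add_one_le_exp (1 / (d : ℝ))
      refine le_trans (le_of_eq ?_) this
      field_simp
      ring
    calc _ ≤ Real.exp (1 / d) ^ d := pow_le_pow_left₀ (by positivity) h1 d
      _ = _ := by rw [← Real.exp_nat_mul]; congr 1; field_simp
  have h1 : volume.real E ≤ (d + 1) * (lam * (Real.exp 1 * volume.real K)) := by
    have h2 : (1 - (d : ℝ) / (d + 1)) = 1 / (d + 1) := by field_simp; ring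
    rw [h2, one_div_mul_eq_div, div_le_iff₀ (by positivity)] at hreal
    refine hreal.trans ?_
    rw [mul_comm]
    gcongr
  refine h1.trans ?_
  have h3 : remezConst m (n + 1) = 4 * Real.exp 1 * Real.exp (2 + γ) * Real.exp 1 := by
    rw [remezConst, bigGamma, Nat.add_sub_cancel, ← hγ, mul_assoc, mul_assoc, ← Real.exp_add,
      ← Real.exp_add]
    congr 2; ring
  rw [h3, hlam]
  have h4 : (1 : ℝ) ≤ Real.exp 1 := Real.one_le_exp zero_le_one
  -- Uses `d + 1 ≤ 2d`; `C_N` has a factor `e` to spare.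
  calc ((d : ℝ) + 1) * (2 * Real.exp (2 + γ) * Real.exp (-u) * (Real.exp 1 * volume.real K))
      ≤ (2 * d) * (2 * Real.exp (2 + γ) * Real.exp (-u) * (Real.exp 1 * volume.real K)) := by
        gcongr; linarith
    _ = 4 * Real.exp 1 * Real.exp (2 + γ) * 1 * d * volume.real K * Real.exp (-u) := by ring
    _ ≤ _ := by gcongr

/-- The mean oscillation of a function is at most twice its mean distance to a constant. -/
theorem meanOscillation_le {d : ℕ} {g : EuclideanSpace ℝ (Fin d) → ℝ}
    {B : Set (EuclideanSpace ℝ (Fin d))} (hB0 : volume B ≠ 0) (hBfin : volume B ≠ ⊤) {c J : ℝ}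
    (hg : IntegrableOn (fun x => c - g x) B) (h0 : ∀ᵐ x ∂(volume.restrict B), 0 ≤ c - g x)
    (hJ : ∫ x in B, (c - g x) ≤ volume.real B * J) : meanOscillation g B ≤ 2 * J := by
  have hb : 0 < volume.real B := ENNReal.toReal_pos hB0 hBfin
  set I := ∫ x in B, (c - g x) with hI
  have hI0 : 0 ≤ I := integral_nonneg_of_ae h0
  have hc : IntegrableOn (fun _ => c) B := integrableOn_const hBfin
  have hgi : ∫ x in B, g x = volume.real B * c - I := by
    have : ∫ x in B, g x = ∫ x in B, (c - (c - g x)) := by simp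
    rw [this, integral_sub hc hg, setIntegral_const, smul_eq_mul]
  have havg : ⨍ y in B, g y = c - (volume.real B)⁻¹ * I := by
    rw [setAverage_eq, hgi, smul_eq_mul]
    field_simp
  have hc' : IntegrableOn (fun _ => (volume.real B)⁻¹ * I) B := integrableOn_const hBfin
  rw [meanOscillation, havg, setAverage_eq, smul_eq_mul]
  -- Both `c - g` and `c` minus the mean of `g` are non-negative, so their difference is bounded by
  -- their sum.
  have hle : ∫ x in B, |g x - (c - (volume.real B)⁻¹ * I)| ≤ 2 * I := by
    calc _ ≤ ∫ x in B, ((c - g x) + (volume.real B)⁻¹ * I) := by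
          refine integral_mono_of_nonneg (Eventually.of_forall fun _ => abs_nonneg _)
            (hg.add hc') ?_
          filter_upwards [h0] with x hx
          have : 0 ≤ (volume.real B)⁻¹ * I := by positivity
          rw [abs_le]
          constructor <;> linarith
      _ = 2 * I := by
          rw [integral_add hg hc', setIntegral_const, smul_eq_mul, ← hI]
          field_simp
          ring
  calc _ ≤ (volume.real B)⁻¹ * (2 * (volume.real B * J)) := by gcongr; linarith
    _ = 2 * J := by field_simp

/-- The case `N = 1`, in which the right-hand side is `∞` by convention, is left out by `hN`.
That `log |f|` is defined almost everywhere and integrable on `B` is part of the conclusion. -/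
theorem mainTheorem9 (d : ℕ) (hd : 1 ≤ d) (K : Set (EuclideanSpace ℝ (Fin d)))
    (μ : ℕ → ℝ) (N : ℕ) (hdata : IsAdmissibleData μ K N) (hN : 2 ≤ N)
    (m : ℝ → ℝ) (hm : IsWeightInterpolant m μ)
    (f : EuclideanSpace ℝ (Fin d) → ℝ)
    (hf : IsWeightSmooth μ (2 * (N - 1)) (supNormOn K f) K f)
    (B : Set (EuclideanSpace ℝ (Fin d))) (hB : IsEuclideanBall B) (hBK : B ⊆ K) :
    (∀ᵐ x ∂(volume.restrict B), f x ≠ 0) ∧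
    IntegrableOn (fun x => Real.log |f x|) B volume ∧
    meanOscillation (fun x => Real.log |f x|) B ≤
      4 * ((N : ℝ) - 1) *
        (Real.log (remezConst m N * (d : ℝ) * volume.real K / volume.real B) + 1) := by
  have hsub := fun u => volume_sublevel_le hd hdata hN hm hf (u := u)
  obtain ⟨hM, ⟨U, hU, hKU, hfU⟩, -⟩ := hf
  set M := supNormOn K f
  set n := N - 1 with hn
  have hNn : (N : ℝ) - 1 = n := by
    rw [hn, Nat.cast_sub (by omega), Nat.cast_one]
  rw [hNn]
  have hn0 : (0 : ℝ) < n := by exact_mod_cast (by omega : 0 < n)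
  have hKc := hdata.body.compact
  have hfc : ContinuousOn f K := hfU.continuousOn.mono hKU
  have hBm : MeasurableSet B := by
    obtain ⟨c, r, -, rfl | rfl⟩ := hB
    exacts [measurableSet_ball, measurableSet_closedBall]
  have hB0 : volume B ≠ 0 := by
    obtain ⟨c, r, hr, rfl | rfl⟩ := hB
    exacts [(Metric.measure_ball_pos _ _ hr).ne', (Metric.measure_closedBall_pos _ _ hr).ne']
  have hBfin : volume B ≠ ⊤ := ((measure_mono hBK).trans_lt hKc.measure_lt_top).ne
  have hb : 0 < volume.real B := ENNReal.toReal_pos hB0 hBfin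
  have hbK : volume.real B ≤ volume.real K := measureReal_mono hBK hKc.measure_lt_top.ne
  have hd1 : (1 : ℝ) ≤ d := by exact_mod_cast hd
  have hC1 : 1 ≤ remezConst m N := by
    have : 1 ≤ Real.exp (4 + gammaSup m (2 * (N - 1))) :=
      Real.one_le_exp (by linarith [hm.gammaSup_nonneg (by omega : 1 ≤ 2 * (N - 1))])
    rw [remezConst, bigGamma]
    linarith
  set Q := remezConst m N * (d : ℝ) * volume.real K with hQ
  have hbQ : volume.real B ≤ Q := by
    have : 1 ≤ remezConst m N * (d : ℝ) := one_le_mul_of_one_le_of_one_le hC1 hd1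
    exact hbK.trans (le_mul_of_one_le_left (hb.le.trans hbK) this)
  have hQ0 : 0 < Q := hb.trans_le hbQ
  set Λ := Real.log (Q / volume.real B) with hΛ
  have hΛ0 : 0 ≤ Λ := Real.log_nonneg ((one_le_div hb).2 hbQ)
  have hexpΛ : volume.real B * Real.exp Λ = Q := by
    rw [hΛ, Real.exp_log (by positivity)]; field_simp
  have hne : ∀ᵐ x ∂(volume.restrict B), f x ≠ 0 := by
    rw [ae_restrict_iff' hBm]
    -- The zero set lies in every sublevel set; let `u → ∞`.
    have hnull : volume {x | x ∈ K ∧ f x = 0} = 0 := by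
      have hlim : Tendsto (fun u : ℝ => ENNReal.ofReal (Q * Real.exp (-u))) atTop (𝓝 0) := by
        have := (Real.tendsto_exp_neg_atTop_nhds_zero.const_mul Q)
        rw [mul_zero] at this
        simpa using ENNReal.tendsto_ofReal this
      refine le_antisymm (ge_of_tendsto' hlim fun u => (measure_mono ?_).trans (hsub u)) zero_le
      rintro x ⟨hx, hx0⟩
      refine ⟨hx, ?_⟩
      rw [hx0, abs_zero]
      positivity
    refine (measure_eq_zero_iff_ae_notMem.1 hnull).mono fun x hx hxB hx0 => hx ⟨hBK hxB, hx0⟩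
  have h0 : ∀ᵐ x ∂(volume.restrict B), 0 ≤ Real.log M - Real.log |f x| := by
    filter_upwards [hne, ae_restrict_mem hBm] with x hx hxB
    exact sub_nonneg.2 (Real.log_le_log (abs_pos.2 hx) (abs_le_supNormOn hKc hfc (hBK hxB)))
  have hmeas : AEMeasurable (fun x => Real.log M - Real.log |f x|) (volume.restrict B) := by
    have h1 : AEMeasurable f (volume.restrict B) := (hfc.mono hBK).aemeasurable hBm
    exact (Real.measurable_log.comp_aemeasurable h1.abs).const_sub _
  -- The tail lemma with `k = 2n` and `b = |B|`; `Λ` is chosen so that `b e^Λ = Q`, the Remez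
  -- constant.
  have hlint : ∫⁻ x in B, ENNReal.ofReal (Real.log M - Real.log |f x|) ≤
      ENNReal.ofReal (2 * n * volume.real B * (Λ + 1)) := by
    refine lintegral_le_of_exp_tail h0 hmeas (by positivity) hb.le hΛ0 ?_ fun u hu => ?_
    · rw [Measure.restrict_apply_univ, ofReal_measureReal hBfin]
    · rw [sub_eq_add_neg, Real.exp_add, ← mul_assoc, hexpΛ]
      refine le_trans ?_ ((Measure.restrict_apply_le B _).trans (hsub u))
      refine measure_mono_ae ?_
      filter_upwards [hne, ae_restrict_mem hBm] with x hx hxB hxu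
      refine ⟨hBK hxB, ?_⟩
      have hxu' : 2 * n * u ≤ Real.log M - Real.log |f x| := hxu
      rw [← Real.log_le_log_iff (abs_pos.2 hx) (by positivity),
        Real.log_mul hM.ne' (Real.exp_pos _).ne', Real.log_exp]
      linarith
  have hint : IntegrableOn (fun x => Real.log M - Real.log |f x|) B := by
    refine ⟨hmeas.aestronglyMeasurable, ?_⟩
    rw [hasFiniteIntegral_iff_ofReal h0]
    exact hlint.trans_lt ENNReal.ofReal_lt_top
  refine ⟨hne, ?_, ?_⟩
  · have := (integrableOn_const (C := Real.log M) hBfin).sub hint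
    exact this.congr (Eventually.of_forall fun x => sub_sub_cancel _ _)
  · have hJ : ∫ x in B, (Real.log M - Real.log |f x|) ≤ volume.real B * (2 * n * (Λ + 1)) := by
      rw [integral_eq_lintegral_of_nonneg_ae h0 hint.aestronglyMeasurable]
      refine ENNReal.toReal_le_of_le_ofReal (by positivity) (hlint.trans (le_of_eq ?_))
      congr 1; ring
    refine (meanOscillation_le hB0 hBfin hint h0 hJ).trans (le_of_eq ?_)
    ring
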